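/- **Setting.** Let $d\ge 1$, $K\ge 1$ be integers, $N=K^d$, and let $C\ge 0$ be real. On $\ell^2(\mathbb Z^d)$ let $(\Delta\psi)(x)=\sum_{|y-x|_1=1}\psi(y)$, let $P_0$ be the orthogonal projection onto the sites of $\Lambda_0=\{0,\dots,K-1\}^d$, let $(U_k\psi)(x)=\psi(x-k)$, and for $k\in K\mathbb Z^d$ let $P_k=U_kP_0U_k^{-1}$. For $\omega\in\Omega=[-C,C]^{\mathbb Z^d}$ put $$H_\omega=\Delta+\sum_{k\in K\mathbb Z^d}\omega_kP_k .$$ For a Borel probability measure $\mu$ on $[-C,C]$, the density of states measure (DOSm) of $\mu$ is the Borel measure $n_\mu$ on $\mathbb R$ with $$\int f\,dn_\mu=\frac1N\int_\Omega \mathrm{Tr}\big(P_0f(H_\omega)P_0\big)\,d\mu^{\otimes\mathbb Z^d}(\omega)\qquad (f\in C_c(\mathbb R)).$$ For such $\mu,\mu'$ let $d_w(\mu,\mu')=\sup\{|\mu(f)-\mu'(f)| : f \text{ Lipschitz on } [-C,C],\ \|f\|_\infty+\sup_{x\ne y}\tfrac{|f(x)-f(y)|}{|x-y|}\le 1\}$.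 The Fourier transform is $\hat g(t)=\frac1{\sqrt{2\pi}}\int e^{-itE}g(E)\,dE$. **Theorem 5.9.** Let $(\nu_\alpha)_{\alpha\in\mathbb N}$ and $\nu$ be Borel probability measures on $[-C,C]$ such that $\nu_\alpha\to\nu$ in the weak-$^*$ topology, and put $\eta_\alpha=d_w(\nu_\alpha,\nu)$. Assume that the DOSm of every $\nu_\alpha$ and the DOSm of $\nu$ are absolutely continuous with respect to Lebesgue measure, with densities $\rho_\alpha$ and $\rho$, and that there are constants $D_1>0$ and $\epsilon>0$, independent of $\alpha$, with $$|\hat\rho_\alpha(t)|\le\frac{D_1}{|t|^{1+\epsilon}},\qquad |\hat\rho(t)|\le\frac{D_1}{|t|^{1+\epsilon}}\qquad\text{for all }\alpha\in\mathbb N,\ t\in\mathbb R\setminus\{0\}.$$ Then $\rho_\alpha$ and $\rho$ agree almost everywhere with continuous functions, and we take these as the densities. Let $\xi_0=(1+\frac1{2d})^{-1}$. There is $\alpha_0\in\mathbb N$ such that $$\eta_\alpha^{\xi_0}\le 2^{-2d}\qquad\text{for all }\alpha\ge\alpha_0,$$ and for every $\alpha_0$ with this property, all $\alpha\ge\alpha_0$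 and all $E\in\mathbb R$, $$|\rho_\alpha(E)-\rho(E)|\le 4\sqrt{\tfrac2\pi}\,\max\Big\{\gamma,\frac{D_1}{\epsilon}\Big\}\;\eta_\alpha^{\frac{\epsilon}{2+\epsilon}\cdot\frac1{1+2d}},$$ where $\gamma=4\max\{4c_b(2d+C),\,N\}$ and $c_b=\frac{4306+837\sqrt6}{5832}$. -/

import Mathlib

open MeasureTheory ProbabilityTheory Set Filter Topology
open scoped CompactlySupported

noncomputable section

namespace RandomSchrodinger

/-- Sites of the lattice `ℤ^d`. -/
abbrev Site (d : ℕ) : Type := Fin d → ℤ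

/-- The complex Hilbert space `ℓ²(ℤ^d)`. -/
def EllTwo (d : ℕ) : Type := lp (fun _ : Site d => ℂ) 2

instance (d : ℕ) : NormedAddCommGroup (EllTwo d) :=
  inferInstanceAs (NormedAddCommGroup (lp (fun _ : Site d => ℂ) 2))

instance (d : ℕ) : InnerProductSpace ℂ (EllTwo d) :=
  inferInstanceAs (InnerProductSpace ℂ (lp (fun _ : Site d => ℂ) 2))

instance (d : ℕ) : CompleteSpace (EllTwo d) :=
  inferInstanceAs (CompleteSpace (lp (fun _ : Site d => ℂ) 2))

/-- Vectors of `ℓ²(ℤ^d)` are functions on the lattice. -/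
instance (d : ℕ) : FunLike (EllTwo d) (Site d) ℂ where
  coe ψ := ψ.1
  coe_injective := Subtype.val_injective

@[ext] theorem EllTwo.ext {d : ℕ} {φ ψ : EllTwo d} (h : ∀ x, φ x = ψ x) : φ = ψ :=
  DFunLike.ext _ _ h

@[simp] theorem EllTwo.zero_apply {d : ℕ} (x : Site d) : (0 : EllTwo d) x = 0 := rfl

theorem EllTwo.norm_rpow_eq {d : ℕ} (ψ : EllTwo d) :
    ‖ψ‖ ^ (2 : ENNReal).toReal = ∑' x, ‖ψ x‖ ^ (2 : ENNReal).toReal :=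
  lp.norm_rpow_eq_tsum (E := fun _ : Site d => ℂ) (by norm_num) ψ

theorem EllTwo.norm_le {d : ℕ} {c : ℝ} (hc : 0 ≤ c) {ψ : EllTwo d}
    (h : ∑' x, ‖ψ x‖ ^ (2 : ENNReal).toReal ≤ c ^ (2 : ENNReal).toReal) : ‖ψ‖ ≤ c :=
  lp.norm_le_of_tsum_le (E := fun _ : Site d => ℂ) (by norm_num) hc h

theorem EllTwo.summable {d : ℕ} (ψ : EllTwo d) :
    Summable fun x => ‖ψ x‖ ^ (2 : ENNReal).toReal :=
  (lp.memℓp (E := fun _ : Site d => ℂ) ψ).summable (by norm_num)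

/-- The canonical basis vector `δ_x`. -/
def delta {d : ℕ} (x : Site d) : EllTwo d := lp.single (E := fun _ : Site d => ℂ) 2 x (1 : ℂ)

/-- The translation `(U_k ψ)(x) = ψ(x - k)` on `ℓ²(ℤ^d)`. -/
def translation {d : ℕ} (k : Site d) : EllTwo d →L[ℂ] EllTwo d :=
  LinearMap.mkContinuous
    { toFun := fun ψ => ⟨fun x => ψ (x - k), memℓp_gen <|
        ((Equiv.subRight k).summable_iff (f := fun x => ‖ψ x‖ ^ (2 : ENNReal).toReal)).mpr
          ψ.summable⟩
      map_add' := fun _ _ => rfl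
      map_smul' := fun _ _ => rfl } 1
    (fun ψ => by
      rw [one_mul]
      refine EllTwo.norm_le (norm_nonneg _) ?_
      rw [EllTwo.norm_rpow_eq]
      exact ((Equiv.subRight k).tsum_eq (fun x => ‖ψ x‖ ^ (2 : ENNReal).toReal)).le)

@[simp] theorem translation_apply {d : ℕ} (k : Site d) (ψ : EllTwo d) (x : Site d) :
    translation k ψ x = ψ (x - k) := rfl

/-- The operator of multiplication by a bounded real function `v` on `ℤ^d`. -/
def multiplication {d : ℕ} (v : Site d → ℝ) (M : ℝ) (hv : ∀ x, |v x| ≤ M) :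
    EllTwo d →L[ℂ] EllTwo d :=
  have key : ∀ (ψ : EllTwo d) (x : Site d),
      ‖(v x : ℂ) * ψ x‖ ^ (2 : ENNReal).toReal ≤
        M ^ (2 : ENNReal).toReal * ‖ψ x‖ ^ (2 : ENNReal).toReal := fun ψ x => by
    rw [← Real.mul_rpow ((abs_nonneg _).trans (hv x)) (norm_nonneg _), norm_mul,
      Complex.norm_real, Real.norm_eq_abs]
    exact Real.rpow_le_rpow (by positivity)
      (mul_le_mul_of_nonneg_right (hv x) (norm_nonneg _)) ENNReal.toReal_nonneg
  have hsum : ∀ ψ : EllTwo d,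
      Summable fun x => M ^ (2 : ENNReal).toReal * ‖ψ x‖ ^ (2 : ENNReal).toReal := fun ψ =>
    ψ.summable.mul_left _
  LinearMap.mkContinuous
    { toFun := fun ψ => ⟨fun x => (v x : ℂ) * ψ x, memℓp_gen <|
        Summable.of_nonneg_of_le (fun _ => by positivity) (key ψ) (hsum ψ)⟩
      map_add' := fun ψ φ => by ext x; exact mul_add _ _ _
      map_smul' := fun c ψ => by ext x; exact mul_left_comm _ _ _ } M
    (fun ψ => by
      have hM : 0 ≤ M := (abs_nonneg _).trans (hv 0)
      refine EllTwo.norm_le (by positivity) ?_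
      rw [Real.mul_rpow hM (norm_nonneg _), EllTwo.norm_rpow_eq, ← tsum_mul_left]
      exact Summable.tsum_le_tsum (key ψ)
        (Summable.of_nonneg_of_le (fun _ => by positivity) (key ψ) (hsum ψ)) (hsum ψ))

@[simp] theorem multiplication_apply {d : ℕ} (v : Site d → ℝ) (M : ℝ) (hv : ∀ x, |v x| ≤ M)
    (ψ : EllTwo d) (x : Site d) : multiplication v M hv ψ x = (v x : ℂ) * ψ x := rfl

/-- The finite-difference Laplacian on `ℤ^d`, `(Δψ)(x) = ∑_{|y - x|₁ = 1} ψ(y)`. -/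
def laplacian (d : ℕ) : EllTwo d →L[ℂ] EllTwo d :=
  ∑ i : Fin d, (translation (Pi.single i (1 : ℤ)) + translation (-Pi.single i (1 : ℤ)))

/-- The cube `Λ₀ = [0, K-1]^d ⊂ ℤ^d`, with `K^d` points. -/
def cube (d K : ℕ) : Finset (Site d) := Fintype.piFinset fun _ => Finset.Ico (0 : ℤ) K

/-- The orthogonal projection `P₀` onto the sites of the cube `Λ₀`. -/
def projZero (d K : ℕ) : EllTwo d →L[ℂ] EllTwo d :=
  multiplication (fun x => if x ∈ cube d K then 1 else 0) 1 (fun x => by split_ifs <;> simp)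

/-- The projection `P_k = U_k P₀ U_k⁻¹`; note that `U_k⁻¹ = U_{-k}`. -/
def proj (d K : ℕ) (k : Site d) : EllTwo d →L[ℂ] EllTwo d :=
  translation k ∘L projZero d K ∘L translation (-k)

/-- The point `k` of the lattice `K ℤ^d` whose cell `k + Λ₀` contains the site `x`. -/
def cellCorner {d : ℕ} (K : ℕ) (x : Site d) : Site d := fun i => (K : ℤ) * (x i / (K : ℤ))

/-- The configuration space `Ω = [-C, C]^(ℤ^d)`. -/
abbrev Config (d : ℕ) (C : ℝ) : Type := Site d → Icc (-C) C

/-- The random potential `∑_{k ∈ K ℤ^d} ω_k P_k`. Since the cells `k + Λ₀` partition `ℤ^d`, it is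
the multiplication by the function with value `ω_k` on `k + Λ₀`; that the series converges strongly
to this operator is `hasSum_potential`. -/
def potential (d K : ℕ) (C : ℝ) (ω : Config d C) : EllTwo d →L[ℂ] EllTwo d :=
  multiplication (fun x => (ω (cellCorner K x) : ℝ)) C (fun x => abs_le.mpr (ω (cellCorner K x)).2)

/-- The random Schrödinger operator `H_ω = Δ + ∑_{k ∈ K ℤ^d} ω_k P_k`. -/
def hamiltonian (d K : ℕ) (C : ℝ) (ω : Config d C) : EllTwo d →L[ℂ] EllTwo d :=
  laplacian d + potential d K C ω

theorem proj_apply {d K : ℕ} (k : Site d) (ψ : EllTwo d) (x : Site d) :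
    proj d K k ψ x = if x - k ∈ cube d K then ψ x else 0 := by
  have : proj d K k ψ x = ((if x - k ∈ cube d K then (1 : ℝ) else 0 : ℝ) : ℂ) * ψ (x - k - -k) :=
    rfl
  rw [this]
  split_ifs <;> simp

theorem mem_cell_iff {d K : ℕ} (hK : 1 ≤ K) (j x : Site d) :
    x - (K : ℤ) • j ∈ cube d K ↔ j = fun i => x i / (K : ℤ) := by
  have hK' : (0 : ℤ) < K := by exact_mod_cast hK
  simp only [cube, Fintype.mem_piFinset, Finset.mem_Ico, Pi.sub_apply, Pi.smul_apply, smul_eq_mul,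
    funext_iff]
  refine forall_congr' fun i => ?_
  rw [eq_comm, Int.ediv_eq_iff_of_pos hK']
  constructor
  · rintro ⟨h1, h2⟩; constructor <;> nlinarith
  · rintro ⟨h1, h2⟩; constructor <;> nlinarith

/-- The potential is the strong sum `∑_{k ∈ K ℤ^d} ω_k P_k`. -/
theorem hasSum_potential {d K : ℕ} (hK : 1 ≤ K) {C : ℝ} (ω : Config d C) (ψ : EllTwo d) :
    HasSum (fun j : Site d => ((ω ((K : ℤ) • j) : ℝ) : ℂ) • proj d K ((K : ℤ) • j) ψ)
      (potential d K C ω ψ) := by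
  set w := potential d K C ω ψ with hw
  let e : Site d → ℂ → EllTwo d := fun x a => lp.single (E := fun _ : Site d => ℂ) 2 x a
  have hE : ∀ φ : EllTwo d, HasSum (fun x => e x (φ x)) φ := fun φ =>
    lp.hasSum_single (E := fun _ : Site d => ℂ) (by norm_num : (2 : ENNReal) ≠ ⊤) φ
  have h0 := hE w
  let q : Site d → Site d := fun x i => x i / (K : ℤ)
  rw [← (Equiv.sigmaFiberEquiv q).hasSum_iff] at h0
  refine h0.sigma fun j => ?_
  have h1 := hE (((ω ((K : ℤ) • j) : ℝ) : ℂ) • proj d K ((K : ℤ) • j) ψ)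
  have hval : ∀ x, (((ω ((K : ℤ) • j) : ℝ) : ℂ) • proj d K ((K : ℤ) • j) ψ) x =
      if q x = j then w x else 0 := by
    intro x
    have e1 : (((ω ((K : ℤ) • j) : ℝ) : ℂ) • proj d K ((K : ℤ) • j) ψ) x =
        ((ω ((K : ℤ) • j) : ℝ) : ℂ) * proj d K ((K : ℤ) • j) ψ x := rfl
    have e2 : w x = ((ω (cellCorner K x) : ℝ) : ℂ) * ψ x := rfl
    rw [e1, e2, proj_apply]
    by_cases hx : q x = j
    · have hc : cellCorner K x = (K : ℤ) • j := by rw [← hx]; rfl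
      rw [if_pos hx, if_pos ((mem_cell_iff hK j x).mpr hx.symm), hc]
    · rw [if_neg hx, if_neg fun h => hx ((mem_cell_iff hK j x).mp h).symm, mul_zero]
  rw [← hasSum_subtype_iff_of_support_subset (s := {x | q x = j})] at h1
  · refine h1.congr_fun fun x => ?_
    have hx : q x = j := x.2
    have := hval x
    rw [if_pos hx] at this
    exact congrArg (e x) this.symm
  · intro x hx
    by_contra hne
    have hne' : ¬ q x = j := hne
    have := hval x
    rw [if_neg hne'] at this
    exact hx ((congrArg (e x) this).trans (lp.single_zero (E := fun _ : Site d => ℂ) 2 x))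

/-! Self-adjointness of `H_ω`, needed for its functional calculus. -/

theorem inner_eq {d : ℕ} (φ ψ : EllTwo d) :
    inner ℂ φ ψ = ∑' x, ψ x * (starRingEnd ℂ) (φ x) := by
  exact lp.inner_eq_tsum (G := fun _ : Site d => ℂ) φ ψ

theorem inner_delta {d : ℕ} (x : Site d) (ψ : EllTwo d) : inner ℂ (delta x) ψ = ψ x := by
  refine (lp.inner_single_left (G := fun _ : Site d => ℂ) x (1 : ℂ) ψ).trans ?_
  simp only [RCLike.inner_apply, map_one, mul_one]
  rfl

theorem inner_translation_left {d : ℕ} (k : Site d) (φ ψ : EllTwo d) :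
    inner ℂ (translation k φ) ψ = inner ℂ φ (translation (-k) ψ) := by
  rw [inner_eq, inner_eq, ← (Equiv.addRight k).tsum_eq]
  refine tsum_congr fun x => ?_
  simp only [translation_apply, Equiv.coe_addRight, add_sub_cancel_right, sub_neg_eq_add]

theorem isSelfAdjoint_laplacian (d : ℕ) : IsSelfAdjoint (laplacian d) := by
  rw [ContinuousLinearMap.isSelfAdjoint_iff_isSymmetric]
  intro φ ψ
  change inner ℂ (laplacian d φ) ψ = inner ℂ φ (laplacian d ψ)
  simp only [laplacian, _root_.sum_apply, sum_inner, inner_sum,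
    _root_.add_apply, inner_add_left, inner_add_right, inner_translation_left, neg_neg]
  exact Finset.sum_congr rfl fun i _ => add_comm _ _

theorem isSelfAdjoint_multiplication {d : ℕ} (v : Site d → ℝ) (M : ℝ) (hv : ∀ x, |v x| ≤ M) :
    IsSelfAdjoint (multiplication v M hv) := by
  rw [ContinuousLinearMap.isSelfAdjoint_iff_isSymmetric]
  intro φ ψ
  change inner ℂ (multiplication v M hv φ) ψ = inner ℂ φ (multiplication v M hv ψ)
  rw [inner_eq, inner_eq]
  refine tsum_congr fun x => ?_
  simp only [multiplication_apply, map_mul, Complex.conj_ofReal]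
  ring

theorem isSelfAdjoint_hamiltonian {d K : ℕ} {C : ℝ} (ω : Config d C) :
    IsSelfAdjoint (hamiltonian d K C ω) :=
  (isSelfAdjoint_laplacian d).add (isSelfAdjoint_multiplication _ _ _)

/-! Traces and the density of states measure. -/

/-- The trace `∑_x ⟨δ_x, A δ_x⟩` in the canonical orthonormal basis. -/
def trace {d : ℕ} (A : EllTwo d →L[ℂ] EllTwo d) : ℂ := ∑' x : Site d, inner ℂ (delta x) (A (delta x))

/-- `Tr (P₀ f(H_ω) P₀)`, where `f(H_ω)` is given by the continuous functional calculus. This is a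
finite sum of real numbers, see `localTrace_eq_sum`. -/
def localTrace (d K : ℕ) (C : ℝ) (f : ℝ → ℝ) (ω : Config d C) : ℝ :=
  (trace (projZero d K ∘L cfc f (hamiltonian d K C ω) ∘L projZero d K)).re

theorem projZero_delta {d K : ℕ} (x : Site d) :
    projZero d K (delta x) = if x ∈ cube d K then delta x else 0 := by
  ext y
  have h1 : projZero d K (delta x) y =
    ((if y ∈ cube d K then (1 : ℝ) else 0 : ℝ) : ℂ) * delta x y := rfl
  rw [h1]
  by_cases hxy : y = x
  · subst hxy
    split_ifs <;> simp
  · have h2 : delta x y = 0 := lp.single_apply_ne (E := fun _ : Site d => ℂ) 2 x (1 : ℂ) hxy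
    split_ifs <;> simp [h2]

theorem localTrace_eq_sum {d K : ℕ} {C : ℝ} (f : ℝ → ℝ) (ω : Config d C) :
    localTrace d K C f ω =
      ∑ x ∈ cube d K, (inner ℂ (delta x) (cfc f (hamiltonian d K C ω) (delta x))).re := by
  have h : ∀ x : Site d, inner ℂ (delta x)
      ((projZero d K ∘L cfc f (hamiltonian d K C ω) ∘L projZero d K) (delta x)) =
      if x ∈ cube d K then inner ℂ (delta x) (cfc f (hamiltonian d K C ω) (delta x)) else 0 := by
    intro x
    change inner ℂ (delta x)
      (projZero d K (cfc f (hamiltonian d K C ω) (projZero d K (delta x)))) = _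
    rw [inner_delta]
    change ((if x ∈ cube d K then (1 : ℝ) else 0 : ℝ) : ℂ) *
      (cfc f (hamiltonian d K C ω) (projZero d K (delta x))) x = _
    rw [projZero_delta, inner_delta]
    split_ifs <;> simp
  rw [localTrace, trace, tsum_congr h, tsum_eq_sum (s := cube d K), Complex.re_sum]
  · exact Finset.sum_congr rfl fun _ hx => by rw [if_pos hx]
  · intro x hx
    rw [if_neg hx]

theorem norm_hamiltonian_le {d K : ℕ} {C : ℝ} (ω : Config d C) :
    ‖hamiltonian d K C ω‖ ≤ 2 * d + C := by
  have hC : 0 ≤ C := (abs_nonneg _).trans (abs_le.mpr (ω 0).2)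
  have hU : ∀ k : Site d, ‖translation k‖ ≤ 1 := fun k =>
    LinearMap.mkContinuous_norm_le _ zero_le_one _
  have hL : ‖laplacian d‖ ≤ 2 * d := by
    refine (norm_sum_le _ _).trans ?_
    refine (Finset.sum_le_card_nsmul _ _ 2 fun i _ => ?_).trans_eq ?_
    · exact (norm_add_le _ _).trans ((add_le_add (hU _) (hU _)).trans_eq one_add_one_eq_two)
    · simp [mul_comm]
  have hV : ‖potential d K C ω‖ ≤ C := by
    unfold potential multiplication
    exact LinearMap.mkContinuous_norm_le _ hC _
  exact (norm_add_le _ _).trans (add_le_add hL hV)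

theorem spectrum_hamiltonian_subset {d K : ℕ} {C : ℝ} (ω : Config d C) :
    spectrum ℝ (hamiltonian d K C ω) ⊆ Icc (-(2 * d + C)) (2 * d + C) := fun _ hx =>
  abs_le.mp <| (spectrum.norm_le_norm_mul_of_mem hx).trans <|
    (mul_le_of_le_one_right (norm_nonneg _) ContinuousLinearMap.norm_id_le).trans
      (norm_hamiltonian_le ω)

theorem continuous_hamiltonian_pow {d K : ℕ} {C : ℝ} (φ : EllTwo d) (n : ℕ) :
    ∀ x : Site d, Continuous fun ω : Config d C => ((hamiltonian d K C ω ^ n) φ) x := by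
  induction n with
  | zero => intro x; simpa using continuous_const
  | succ n ih =>
    intro x
    have key : ∀ ω : Config d C, ((hamiltonian d K C ω ^ (n + 1)) φ) x =
        (∑ i : Fin d, (((hamiltonian d K C ω ^ n) φ) (x - Pi.single i 1) +
          ((hamiltonian d K C ω ^ n) φ) (x - -Pi.single i 1))) +
        ((ω (cellCorner K x) : ℝ) : ℂ) * ((hamiltonian d K C ω ^ n) φ) x := by
      intro ω
      rw [pow_succ']
      change (hamiltonian d K C ω ((hamiltonian d K C ω ^ n) φ)) x = _
      generalize (hamiltonian d K C ω ^ n) φ = ψ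
      rw [← inner_delta x (hamiltonian d K C ω ψ), hamiltonian, laplacian]
      simp only [_root_.add_apply, _root_.sum_apply, inner_add_right,
        inner_sum, inner_delta, translation_apply]
      rfl
    simp only [key]
    have hω : Continuous fun ω : Config d C => ((ω (cellCorner K x) : ℝ) : ℂ) :=
      Complex.continuous_ofReal.comp (continuous_subtype_val.comp (continuous_apply _))
    have hsum : Continuous fun ω : Config d C =>
        ∑ i : Fin d, (((hamiltonian d K C ω ^ n) φ) (x - Pi.single i 1) +
          ((hamiltonian d K C ω ^ n) φ) (x - -Pi.single i 1)) :=
      continuous_finsetSum _ fun i _ => (ih _).add (ih _)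
    exact hsum.add (hω.mul (ih x))

theorem norm_delta {d : ℕ} (x : Site d) : ‖delta x‖ = 1 := by
  refine (lp.norm_single (E := fun _ : Site d => ℂ) (by norm_num) x (1 : ℂ)).trans ?_
  simp

/-- Matrix elements of `f(H_ω)` depend continuously on `ω`. -/
theorem continuous_inner_cfc {d K : ℕ} {C : ℝ} {f : ℝ → ℝ} (hf : Continuous f) (x : Site d) :
    Continuous fun ω : Config d C =>
      inner ℂ (delta x) (cfc f (hamiltonian d K C ω) (delta x)) := by
  have hpoly : ∀ p : Polynomial ℝ, Continuous fun ω : Config d C =>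
      inner ℂ (delta x) (cfc (fun y => p.eval y) (hamiltonian d K C ω) (delta x)) := by
    intro p
    have : ∀ ω : Config d C,
        inner ℂ (delta x) (cfc (fun y => p.eval y) (hamiltonian d K C ω) (delta x)) =
        p.sum fun n a => (a : ℂ) * ((hamiltonian d K C ω ^ n) (delta x)) x := by
      intro ω
      rw [cfc_polynomial p _ (isSelfAdjoint_hamiltonian ω), Polynomial.aeval_eq_sum_range,
        Polynomial.sum_over_range _ (by simp)]
      simp only [_root_.sum_apply, inner_sum]
      refine Finset.sum_congr rfl fun n _ => ?_
      rw [inner_delta]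
      rfl
    simp only [this, Polynomial.sum]
    exact continuous_finsetSum _ fun n _ =>
      continuous_const.mul (continuous_hamiltonian_pow (delta x) n x)
  refine continuous_of_uniform_approx_of_continuous fun u hu => ?_
  obtain ⟨ε, hε, hεu⟩ := Metric.mem_uniformity_dist.mp hu
  obtain ⟨p, hp⟩ := exists_polynomial_near_of_continuousOn (-(2 * d + C)) (2 * d + C) f
    hf.continuousOn (ε / 2) (half_pos hε)
  refine ⟨_, hpoly p, fun ω => hεu ?_⟩
  have hsub : cfc f (hamiltonian d K C ω) - cfc (fun y => p.eval y) (hamiltonian d K C ω) =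
      cfc (fun y => f y - p.eval y) (hamiltonian d K C ω) :=
    (cfc_sub f (fun y => p.eval y) _ hf.continuousOn p.continuous.continuousOn).symm
  have hn : ‖cfc (fun y => f y - p.eval y) (hamiltonian d K C ω)‖ ≤ ε / 2 := by
    refine norm_cfc_le (half_pos hε).le fun y hy => ?_
    rw [Real.norm_eq_abs, abs_sub_comm]
    exact (hp y (spectrum_hamiltonian_subset ω hy)).le
  rw [dist_eq_norm, ← inner_sub_right, ← _root_.sub_apply, hsub]
  refine ((norm_inner_le_norm _ _).trans ?_).trans_lt (half_lt_self hε)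
  rw [norm_delta, one_mul]
  exact ((ContinuousLinearMap.le_opNorm _ _).trans_eq (by rw [norm_delta, mul_one])).trans hn

theorem continuous_localTrace {d K : ℕ} {C : ℝ} {f : ℝ → ℝ} (hf : Continuous f) :
    Continuous fun ω : Config d C => localTrace d K C f ω := by
  simp only [localTrace_eq_sum]
  exact continuous_finsetSum _ fun x _ =>
    Complex.continuous_re.comp (continuous_inner_cfc hf x)

/-- The infinite product `⨂_{k ∈ ℤ^d} ν` of a single-site probability measure on `[-C, C]`. -/
def productLaw (d : ℕ) {C : ℝ} (ν : ProbabilityMeasure (Icc (-C) C)) : Measure (Config d C) :=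
  Measure.infinitePi fun _ : Site d => (ν : Measure (Icc (-C) C))

instance isProbabilityMeasure_productLaw (d : ℕ) {C : ℝ} (ν : ProbabilityMeasure (Icc (-C) C)) :
    IsProbabilityMeasure (productLaw d ν) := by
  unfold productLaw
  infer_instance

theorem integrable_localTrace {d K : ℕ} {C : ℝ} (ν : ProbabilityMeasure (Icc (-C) C))
    {f : ℝ → ℝ} (hf : Continuous f) : Integrable (localTrace d K C f) (productLaw d ν) :=
  (continuous_localTrace hf).integrable_of_hasCompactSupport
    (HasCompactSupport.of_compactSpace _)

theorem localTrace_nonneg {d K : ℕ} {C : ℝ} {f : ℝ → ℝ} (hf0 : ∀ y, 0 ≤ f y)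
    (ω : Config d C) : 0 ≤ localTrace d K C f ω := by
  rw [localTrace_eq_sum]
  refine Finset.sum_nonneg fun x _ => ?_
  have h : 0 ≤ cfc f (hamiltonian d K C ω) := cfc_nonneg fun y _ => hf0 y
  exact ((ContinuousLinearMap.nonneg_iff_isPositive _).mp h).re_inner_nonneg_right (delta x)

/-- The positive linear functional `f ↦ (1/N) 𝔼 Tr (P₀ f(H_ω) P₀)`, `N = K^d`, on `C_c(ℝ)`. -/
def dosFunctional (d K : ℕ) {C : ℝ} (ν : ProbabilityMeasure (Icc (-C) C)) :
    C_c(ℝ, ℝ) →ₚ[ℝ] ℝ :=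
  PositiveLinearMap.mk₀
    { toFun := fun f => ((K : ℝ) ^ d)⁻¹ * ∫ ω, localTrace d K C f ω ∂(productLaw d ν)
      map_add' := fun f g => by
        rw [← mul_add, ← integral_add (integrable_localTrace ν (map_continuous f))
          (integrable_localTrace ν (map_continuous g))]
        refine congrArg _ (integral_congr_ae (Eventually.of_forall fun ω => ?_))
        have : cfc (⇑(f + g)) (hamiltonian d K C ω) =
            cfc f (hamiltonian d K C ω) + cfc g (hamiltonian d K C ω) :=
          cfc_add (a := hamiltonian d K C ω) f g (map_continuous f).continuousOn (map_continuous g).continuousOn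
        simp only [localTrace_eq_sum, this, _root_.add_apply, inner_add_right,
          Complex.add_re, Finset.sum_add_distrib]
      map_smul' := fun c f => by
        rw [RingHom.id_apply, smul_eq_mul, mul_left_comm, ← integral_const_mul c]
        refine congrArg _ (integral_congr_ae (Eventually.of_forall fun ω => ?_))
        have : cfc (⇑(c • f)) (hamiltonian d K C ω) = c • cfc f (hamiltonian d K C ω) :=
          cfc_smul c f _ (map_continuous f).continuousOn
        simp only [localTrace_eq_sum, this, _root_.smul_apply, Finset.mul_sum]
        refine Finset.sum_congr rfl fun x _ => ?_
        rw [inner_smul_right_eq_smul, Complex.smul_re, smul_eq_mul] }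
    (fun f hf => mul_nonneg (by positivity)
      (integral_nonneg fun ω => localTrace_nonneg (fun y => hf y) ω))

/-- The density of states measure: the Borel measure on `ℝ` that represents
`f ↦ (1/N) 𝔼 Tr (P₀ f(H_ω) P₀)`. -/
def dosMeasure (d K : ℕ) {C : ℝ} (ν : ProbabilityMeasure (Icc (-C) C)) : Measure ℝ :=
  RealRMK.rieszMeasure (dosFunctional d K ν)

theorem integral_dosMeasure (d K : ℕ) {C : ℝ} (ν : ProbabilityMeasure (Icc (-C) C))
    (f : C_c(ℝ, ℝ)) : ∫ E, f E ∂(dosMeasure d K ν) =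
      ((K : ℝ) ^ d)⁻¹ * ∫ ω, localTrace d K C f ω ∂(productLaw d ν) :=
  RealRMK.integral_rieszMeasure (dosFunctional d K ν) f

/-- The density of states function: the Lebesgue density of the density of states measure. -/
def dosDensity (d K : ℕ) {C : ℝ} (ν : ProbabilityMeasure (Icc (-C) C)) (E : ℝ) : ℝ :=
  ((dosMeasure d K ν).rnDeriv volume E).toReal

/-- The Fourier transform with the unitary normalization, `ĝ(t) = (2π)^(-1/2) ∫ e^(-itE) g(E) dE`. -/
def fourierHat (g : ℝ → ℝ) (t : ℝ) : ℂ :=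
  ((Real.sqrt (2 * Real.pi))⁻¹ : ℝ) * ∫ E : ℝ, Complex.exp (-(Complex.I * t * E)) * (g E : ℂ)

/-! The metric `d_w` on the single-site probability measures. -/

/-- The Lipschitz norm `‖f‖_∞ + sup_{x ≠ y} |f x - f y| / |x - y|` of a Lipschitz function on
`[-C, C]`; the terms with `x = y` are `0 / 0 = 0` and do not affect the supremum. -/
def lipNorm {C : ℝ} (f : Icc (-C) C → ℝ) : ℝ :=
  (⨆ x, |f x|) + ⨆ p : Icc (-C) C × Icc (-C) C, |f p.1 - f p.2| / |(p.1 : ℝ) - (p.2 : ℝ)|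

/-- `d_w(μ, ν) = sup { |μ(f) - ν(f)| : f ∈ Lip([-C, C]), ‖f‖_Lip ≤ 1 }`. -/
def distW {C : ℝ} (μ ν : ProbabilityMeasure (Icc (-C) C)) : ℝ :=
  sSup {t : ℝ | ∃ f : Icc (-C) C → ℝ, (∃ L, LipschitzWith L f) ∧ lipNorm f ≤ 1 ∧
    t = |(∫ x, f x ∂(μ : Measure (Icc (-C) C))) - ∫ x, f x ∂(ν : Measure (Icc (-C) C))|}

/-! The constants. -/

/-- Sikkema's constant for Bernstein approximation, `(4306 + 837 √6) / 5832`. -/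
def bernsteinConst : ℝ := (4306 + 837 * Real.sqrt 6) / 5832

/-- `γ = 4 max {4 c_b r, N}` with `r = 2 d + C` and `N = K^d`. -/
def gammaConst (d K : ℕ) (C : ℝ) : ℝ :=
  4 * max (4 * bernsteinConst * (2 * d + C)) ((K : ℝ) ^ d)

/-- `4 √(2/π) max {γ, D₁ / ε}`. -/
def dosConst (d K : ℕ) (C D₁ ε : ℝ) : ℝ :=
  4 * Real.sqrt (2 / Real.pi) * max (gammaConst d K C) (D₁ / ε)

/-- The condition on the index `α₀`: with `ξ₀ = (1 + (2d)⁻¹)⁻¹`, one has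
`η_α ^ ξ₀ ≤ 2 ^ (-2d)` for all `α ≥ α₀`. -/
def IsThreshold (d : ℕ) (η : ℕ → ℝ) (α₀ : ℕ) : Prop :=
  ∀ α, α₀ ≤ α → η α ^ ((1 + (2 * (d : ℝ))⁻¹)⁻¹ : ℝ) ≤ 1 / 2 ^ (2 * d)

end RandomSchrodinger
end

open RandomSchrodinger

/-! Both densities are recovered from their Fourier transforms, so up to `(√(2π))⁻¹` their sup
distance is at most the `L¹` distance of the transforms (`ae_eq_fourierHatInv_fourierHat`,
`norm_fourierHatInv_sub_le`). That integral is split at `|t| = T` (`integral_norm_sub_le`). Beyond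
`T` the assumed decay contributes a multiple of `D₁ T^(-ε) / ε`.

For `|t| ≤ T` the two transforms are compared through expectations of `⟨δ_x, cos (t H_ω + φ) δ_x⟩`;
the phase `φ` turns a complex modulus into a real part. With `r = 2d + C`, two properties of this
matrix element give `abs_integral_cosElement_sub_le`. First, it is nearly local: its Taylor
polynomial of degree below `m` involves only walks of length below `m`, so freezing the potential
outside the radius-`m` ball costs `O((|t| r)^m / m!)`. Second, by Duhamel's formula it is
`|t|`-Lipschitz in each `ω_k`, and it is bounded by 1, so replacing one factor of the product
measure costs at most `(1 + |t|) d_w`. At most `(2m+1)^d` factors are replaced.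

With `η ≤ q^(1+2d)` and `m ≈ 1/q`, the factorial beats the tail, and `q^(1+2d)` absorbs both the
volume `(4/q)^d` and its constant; what remains is at most `40 r q T` (`exists_radius`). The low
frequencies then contribute a multiple of `T · qT`, which equals `T^(-ε)` for `T = q^(-1/(2+ε))`.
Both parts are of order `q^(ε/(2+ε))`, and `q = η^(1/(1+2d))` yields the exponent of the theorem. -/

noncomputable section

namespace RandomSchrodinger

/-! ### Trigonometric functions of self-adjoint elements -/

section Trigonometric

variable {A : Type*} [CStarAlgebra A]

theorem norm_exp_I_smul_le {a : A} (ha : IsSelfAdjoint a) : ‖NormedSpace.exp (Complex.I • a)‖ ≤ 1 := by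
  nontriviality A
  exact (CStarRing.norm_of_mem_unitary (selfAdjoint.expUnitary ⟨a, ha⟩).2).le

/-- Duhamel's argument: along `s ↦ e^{i(1-s)a} e^{isb}` the derivative is `i(b - a)` between two
unitaries, so the endpoints differ by at most `‖a - b‖`. No commutation of `a` and `b` is needed. -/
theorem norm_exp_I_smul_sub_exp_I_smul_le {a b : A} (ha : IsSelfAdjoint a) (hb : IsSelfAdjoint b) :
    ‖NormedSpace.exp (Complex.I • a) - NormedSpace.exp (Complex.I • b)‖ ≤ ‖a - b‖ := by
  let g : ℝ → A := fun s =>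
    NormedSpace.exp ((1 - s) • (Complex.I • a)) * NormedSpace.exp (s • (Complex.I • b))
  have hnorm : ∀ (s : ℝ) {c : A}, IsSelfAdjoint c → ‖NormedSpace.exp (s • (Complex.I • c))‖ ≤ 1 := by
    intro s c hc
    rw [smul_comm]
    exact norm_exp_I_smul_le ((IsSelfAdjoint.all s).smul hc)
  have hg : ∀ s : ℝ, HasDerivAt g
      (NormedSpace.exp ((1 - s) • (Complex.I • a)) * (Complex.I • (b - a)) *
        NormedSpace.exp (s • (Complex.I • b))) s := by
    intro s
    have h1 : HasDerivAt (fun u : ℝ => NormedSpace.exp ((1 - u) • (Complex.I • a)))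
        (-(NormedSpace.exp ((1 - s) • (Complex.I • a)) * (Complex.I • a))) s := by
      have := (hasDerivAt_exp_smul_const (𝕂 := ℝ) (Complex.I • a) (1 - s)).scomp s
        ((hasDerivAt_id s).const_sub 1)
      simpa [Function.comp_def] using this
    have h2 := hasDerivAt_exp_smul_const' (𝕂 := ℝ) (Complex.I • b) s
    refine (h1.mul h2).congr_deriv ?_
    rw [smul_sub, mul_sub, sub_mul]
    noncomm_ring
  have key := Convex.norm_image_sub_le_of_norm_hasDerivWithin_le (f := g) (C := ‖a - b‖)
    (s := univ) (x := 1) (y := 0) (fun s _ => (hg s).hasDerivWithinAt) (fun s _ => ?_)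
    convex_univ (mem_univ _) (mem_univ _)
  · simpa [g] using key
  · refine (norm_mul₃_le).trans ?_
    rw [norm_smul, Complex.norm_I, one_mul, norm_sub_rev b a]
    calc _ ≤ 1 * ‖a - b‖ * 1 := by
          gcongr
          · exact hnorm _ ha
          · exact hnorm _ hb
      _ = _ := by ring

/-- Euler's formula for the continuous functional calculus. -/
theorem cfc_cos_eq {a : A} (ha : IsSelfAdjoint a) (t φ : ℝ) :
    cfc (fun E : ℝ => Real.cos (t * E + φ)) a =
      (Complex.exp (φ * Complex.I) / 2) • NormedSpace.exp (Complex.I • (t • a)) +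
        (Complex.exp (-(φ * Complex.I)) / 2) • NormedSpace.exp (Complex.I • ((-t) • a)) := by
  have hexp : ∀ s : ℝ, NormedSpace.exp (Complex.I • (s • a)) =
      cfc (fun z : ℂ => Complex.exp (Complex.I * s * z)) a := by
    intro s
    have hn : IsStarNormal (Complex.I • (s • a)) := by
      rw [← Complex.coe_smul s a, smul_smul]
      exact ha.isStarNormal.smul _
    rw [← CFC.complex_exp_eq_normedSpace_exp hn, ← Complex.coe_smul s a, smul_smul,
      ← cfc_comp_smul (Complex.I * s) Complex.exp a (by fun_prop) ha.isStarNormal]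
    rfl
  -- Passing to the complex calculus lets the cosine split into exponentials; on the spectrum `z.re
  -- = z`, so the two calculi agree.
  rw [hexp, hexp, cfc_real_eq_complex _ ha, ← cfc_smul _ _ a (by fun_prop),
    ← cfc_smul _ _ a (by fun_prop), ← cfc_add a _ _ (by fun_prop) (by fun_prop)]
  refine cfc_congr fun z hz => ?_
  have hz' : ((z.re : ℝ) : ℂ) = z :=
    (SpectrumRestricts.real_iff.mp ha.spectrumRestricts _ hz).symm
  simp only [smul_eq_mul, Complex.ofReal_cos, Complex.cos]
  push_cast
  rw [hz', div_mul_eq_mul_div, div_mul_eq_mul_div, ← Complex.exp_add, ← Complex.exp_add, ← add_div]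
  congr 3 <;> ring

/-- In Euler's formula the phase enters only through two coefficients of modulus `1/2`, so the
Duhamel bound for the frequencies `t` and `-t` survives uniformly in `φ`. -/
theorem norm_cfc_cos_sub_cfc_cos_le {a b : A} (ha : IsSelfAdjoint a) (hb : IsSelfAdjoint b)
    (t φ : ℝ) : ‖cfc (fun E : ℝ => Real.cos (t * E + φ)) a -
      cfc (fun E : ℝ => Real.cos (t * E + φ)) b‖ ≤ |t| * ‖a - b‖ := by
  have hs : ∀ s : ℝ, ‖NormedSpace.exp (Complex.I • (s • a)) -
      NormedSpace.exp (Complex.I • (s • b))‖ ≤ |s| * ‖a - b‖ := by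
    intro s
    refine (norm_exp_I_smul_sub_exp_I_smul_le ((IsSelfAdjoint.all s).smul ha)
      ((IsSelfAdjoint.all s).smul hb)).trans_eq ?_
    rw [← smul_sub, norm_smul, Real.norm_eq_abs]
  rw [cfc_cos_eq ha, cfc_cos_eq hb, add_sub_add_comm, ← smul_sub, ← smul_sub]
  refine (norm_add_le _ _).trans ?_
  have h1 := hs t
  have h2 := hs (-t)
  rw [abs_neg] at h2
  have e1 : ‖Complex.exp (φ * Complex.I) / 2‖ = 1 / 2 := by
    rw [norm_div, Complex.norm_exp_ofReal_mul_I]; simp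
  have e2 : ‖Complex.exp (-(φ * Complex.I)) / 2‖ = 1 / 2 := by
    rw [norm_div, ← neg_mul, ← Complex.ofReal_neg, Complex.norm_exp_ofReal_mul_I]; simp
  rw [norm_smul, norm_smul, e1, e2]
  linarith

theorem norm_cfc_cos_le (a : A) (t φ : ℝ) :
    ‖cfc (fun E : ℝ => Real.cos (t * E + φ)) a‖ ≤ 1 :=
  norm_cfc_le zero_le_one fun _ _ => by simpa using Real.abs_cos_le_one _

end Trigonometric

/-- Taylor approximation of `E ↦ cos (t E + φ)`. -/
theorem exists_polynomial_cos_approx (t φ r : ℝ) (m : ℕ) (hm : 0 < m)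
    (h : |t| * r / (m + 1) ≤ 1 / 2) : ∃ p : Polynomial ℝ, p.natDegree < m ∧
      ∀ E : ℝ, |E| ≤ r → |Real.cos (t * E + φ) - p.eval E| ≤ (|t| * r) ^ m / m.factorial * 2 := by
  -- Real parts of the Taylor coefficients of `E ↦ e^{iφ} e^{itE}`, whose real part is the cosine.
  let c : ℕ → ℝ := fun j =>
    (Complex.exp (φ * Complex.I) * ((t * Complex.I) ^ j / (j.factorial : ℂ))).re
  refine ⟨∑ j ∈ Finset.range m, Polynomial.C (c j) * Polynomial.X ^ j, ?_, fun E hE => ?_⟩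
  · refine lt_of_le_of_lt (Polynomial.natDegree_sum_le_of_forall_le _ _ (n := m - 1) fun j hj => ?_)
      (by omega)
    have := Finset.mem_range.mp hj
    exact (Polynomial.natDegree_C_mul_X_pow_le _ _).trans (by omega)
  · set z : ℂ := t * E * Complex.I with hz
    have hzn : ‖z‖ ≤ |t| * r := by
      rw [hz, ← Complex.ofReal_mul, norm_mul, Complex.norm_I, mul_one, Complex.norm_real,
        Real.norm_eq_abs, abs_mul]
      gcongr
    -- The remainder bound `2 ‖z‖^m / m!` requires `‖z‖ / (m + 1) ≤ 1/2`; this is the origin of the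
    -- hypothesis `h`.
    have hb := Complex.exp_bound' (x := z) (n := m)
      ((div_le_div_of_nonneg_right hzn (by positivity)).trans (by exact_mod_cast h))
    have e : Real.cos (t * E + φ) -
        (∑ j ∈ Finset.range m, Polynomial.C (c j) * Polynomial.X ^ j).eval E =
        (Complex.exp (φ * Complex.I) *
          (Complex.exp z - ∑ j ∈ Finset.range m, z ^ j / (j.factorial : ℂ))).re := by
      rw [mul_sub, ← Complex.exp_add, Complex.sub_re, Finset.mul_sum, Complex.re_sum,
        Polynomial.eval_finsetSum]
      congr 1
      · rw [hz, ← Complex.exp_ofReal_mul_I_re]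
        congr 2
        push_cast
        ring
      · refine Finset.sum_congr rfl fun j _ => ?_
        simp only [Polynomial.eval_mul, Polynomial.eval_C, Polynomial.eval_pow, Polynomial.eval_X, c]
        rw [← Complex.re_mul_ofReal]
        congr 1
        rw [hz]
        push_cast
        ring
    rw [e]
    refine (Complex.abs_re_le_norm _).trans ?_
    rw [norm_mul, Complex.norm_exp_ofReal_mul_I, one_mul]
    refine hb.trans ?_
    gcongr

/-! ### Replacing the factors of an infinite product measure -/

section ProductMeasure

variable {ι X : Type*} [MeasurableSpace X]

theorem measurable_update_pair [DecidableEq ι] (k : ι) :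
    Measurable fun p : (ι → X) × X => Function.update p.1 k p.2 := by
  refine measurable_pi_iff.mpr fun i => ?_
  by_cases h : i = k
  · subst h; simpa using measurable_snd
  · simpa [h, Function.comp_def] using (measurable_pi_apply i).comp measurable_fst

/-- Resampling one coordinate independently from `m` replaces that factor of the product. It
suffices to test on finite boxes, whose preimage is a box with side `k` removed times the condition
on the new coordinate. -/
theorem map_update_infinitePi_prod [DecidableEq ι] (μ : ι → Measure X)
    [∀ i, IsProbabilityMeasure (μ i)] (k : ι) (m : Measure X) [IsProbabilityMeasure m]
    [∀ i, IsProbabilityMeasure (Function.update μ k m i)] :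
    ((Measure.infinitePi μ).prod m).map (fun p => Function.update p.1 k p.2) =
      Measure.infinitePi (Function.update μ k m) := by
  refine Measure.eq_infinitePi _ fun s t ht => ?_
  rw [Measure.map_apply (measurable_update_pair k) (MeasurableSet.pi s.countable_toSet fun i _ => ht i)]
  have hpre : (fun p : (ι → X) × X => Function.update p.1 k p.2) ⁻¹' (Set.pi s t) =
      (Set.pi (s.erase k : Finset ι) t) ×ˢ (if k ∈ s then t k else univ) := by
    ext p
    simp only [mem_preimage, Set.mem_pi, mem_prod, Finset.coe_erase, Set.mem_sdiff, Finset.mem_coe,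
      mem_singleton_iff]
    constructor
    · refine fun h => ⟨fun i hi => by simpa [hi.2] using h i hi.1, ?_⟩
      split_ifs with hk
      · simpa using h k hk
      · trivial
    · rintro ⟨h1, h2⟩ i hi
      by_cases hik : i = k
      · subst hik; simpa [hi] using h2
      · simpa [hik] using h1 i ⟨hi, hik⟩
  rw [hpre, Measure.prod_prod, Measure.infinitePi_pi _ fun i _ => ht i]
  have hprod : ∏ i ∈ s.erase k, Function.update μ k m i (t i) = ∏ i ∈ s.erase k, μ i (t i) :=
    Finset.prod_congr rfl fun i hi => by rw [Function.update_of_ne (Finset.ne_of_mem_erase hi)]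
  by_cases hk : k ∈ s
  · rw [if_pos hk, ← Finset.prod_erase_mul s _ hk, hprod, Function.update_self]
  · rw [if_neg hk, measure_univ, mul_one, ← hprod, Finset.erase_eq_of_notMem hk]

theorem integral_infinitePi_update [DecidableEq ι] (μ : ι → Measure X)
    [∀ i, IsProbabilityMeasure (μ i)] (k : ι) (m : Measure X) [IsProbabilityMeasure m]
    [∀ i, IsProbabilityMeasure (Function.update μ k m i)] {F : (ι → X) → ℝ} (hF : Measurable F)
    {B : ℝ} (hB : ∀ ω, |F ω| ≤ B) :
    ∫ ω, F ω ∂Measure.infinitePi (Function.update μ k m) =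
      ∫ ω, ∫ x, F (Function.update ω k x) ∂m ∂Measure.infinitePi μ := by
  rw [← map_update_infinitePi_prod, integral_map (measurable_update_pair k).aemeasurable
    hF.aestronglyMeasurable, integral_prod]
  exact Integrable.of_bound (hF.comp (measurable_update_pair k)).aestronglyMeasurable B
    (Eventually.of_forall fun p => hB _)

/-- Changing finitely many factors of a product measure one at a time. -/
theorem abs_integral_infinitePi_sub_le [DecidableEq ι] (μ μ' : Measure X) [IsProbabilityMeasure μ]
    [IsProbabilityMeasure μ'] {F : (ι → X) → ℝ} (hF : Measurable F) {B δ : ℝ}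
    (hB : ∀ ω, |F ω| ≤ B)
    (h : ∀ (k : ι) (ω : ι → X),
      |∫ x, F (Function.update ω k x) ∂μ' - ∫ x, F (Function.update ω k x) ∂μ| ≤ δ)
    (S : Finset ι) [hp : ∀ (S : Finset ι) (i : ι), IsProbabilityMeasure (if i ∈ S then μ' else μ)] :
    |∫ ω, F ω ∂Measure.infinitePi (fun i => if i ∈ S then μ' else μ) -
      ∫ ω, F ω ∂Measure.infinitePi (fun _ : ι => μ)| ≤ S.card * δ := by
  induction S using Finset.induction_on with
  | empty => simp
  | insert k S hk ih =>
    have e1 : (fun i => if i ∈ insert k S then μ' else μ) =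
        Function.update (fun i => if i ∈ S then μ' else μ) k μ' := by
      ext1 i
      by_cases hi : i = k
      · subst hi; simp
      · simp [hi]
    -- Since `k ∉ S`, resampling coordinate `k` from `μ` changes nothing. The old and the new
    -- measure are thus both resamplings of the same measure, and their difference is an average of
    -- the one-coordinate differences in `h`.
    have e2 : (fun i => if i ∈ S then μ' else μ) =
        Function.update (fun i => if i ∈ S then μ' else μ) k μ := by
      rw [eq_comm, Function.update_eq_self_iff]
      simp [hk]
    have : ∀ i, IsProbabilityMeasure (Function.update (fun i => if i ∈ S then μ' else μ) k μ' i) := by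
      intro i; rw [← e1]; exact hp _ i
    have : ∀ i, IsProbabilityMeasure (Function.update (fun i => if i ∈ S then μ' else μ) k μ i) := by
      intro i; rw [← e2]; exact hp S i
    have i1 := integral_infinitePi_update (fun i => if i ∈ S then μ' else μ) k μ' hF hB
    have i2 := integral_infinitePi_update (fun i => if i ∈ S then μ' else μ) k μ hF hB
    have c1 : ∫ ω, F ω ∂Measure.infinitePi (fun i => if i ∈ insert k S then μ' else μ) =
        ∫ ω, ∫ x, F (Function.update ω k x) ∂μ' ∂Measure.infinitePi
          (fun i => if i ∈ S then μ' else μ) := by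
      rw [← i1]; congr!
    have c2 : ∫ ω, F ω ∂Measure.infinitePi (fun i => if i ∈ S then μ' else μ) =
        ∫ ω, ∫ x, F (Function.update ω k x) ∂μ ∂Measure.infinitePi
          (fun i => if i ∈ S then μ' else μ) := by
      rw [← i2]; congr!
    have hint : ∀ (m : Measure X) [IsProbabilityMeasure m], Integrable
        (fun ω => ∫ x, F (Function.update ω k x) ∂m)
        (Measure.infinitePi (fun i => if i ∈ S then μ' else μ)) := by
      intro m _
      refine Integrable.of_bound (C := B) ?_ (Eventually.of_forall fun ω => ?_)
      · exact ((hF.comp (measurable_update_pair k)).stronglyMeasurable.integral_prod_right'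
          ).aestronglyMeasurable
      · refine (norm_integral_le_of_norm_le_const (C := B)
          (Eventually.of_forall fun x => hB _)).trans_eq (by simp)
    have hstep : |∫ ω, F ω ∂Measure.infinitePi (fun i => if i ∈ insert k S then μ' else μ) -
        ∫ ω, F ω ∂Measure.infinitePi (fun i => if i ∈ S then μ' else μ)| ≤ δ := by
      rw [c1, c2, ← integral_sub (hint μ') (hint μ), ← Real.norm_eq_abs]
      refine (norm_integral_le_of_norm_le_const (C := δ)
        (μ := Measure.infinitePi (fun i => if i ∈ S then μ' else μ))
        (Eventually.of_forall fun ω => ?_)).trans_eq ?_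
      · exact h k ω
      · rw [probReal_univ, mul_one]
    refine (abs_sub_le _ _ _).trans ((add_le_add hstep ih).trans_eq ?_)
    rw [Finset.card_insert_of_notMem hk]
    push_cast
    ring

/-- The same bound for the full product measures, if the integrand depends on the coordinates in
`S` only. -/
theorem abs_integral_infinitePi_sub_le_of_dependsOn [DecidableEq ι] (μ μ' : Measure X)
    [IsProbabilityMeasure μ] [IsProbabilityMeasure μ'] {F : (ι → X) → ℝ} (hF : Measurable F)
    {B δ : ℝ} (hB : ∀ ω, |F ω| ≤ B)
    (h : ∀ (k : ι) (ω : ι → X),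
      |∫ x, F (Function.update ω k x) ∂μ' - ∫ x, F (Function.update ω k x) ∂μ| ≤ δ)
    (S : Finset ι) (x₀ : X) (hS : ∀ ω, F (fun i => if i ∈ S then ω i else x₀) = F ω) :
    |∫ ω, F ω ∂Measure.infinitePi (fun _ : ι => μ') -
      ∫ ω, F ω ∂Measure.infinitePi (fun _ : ι => μ)| ≤ S.card * δ := by
  have : ∀ (S : Finset ι) (i : ι), IsProbabilityMeasure (if i ∈ S then μ' else μ) := by
    intro S i; split_ifs <;> infer_instance
  let G : (S → X) → ℝ := fun y => F fun i => if hi : i ∈ S then y ⟨i, hi⟩ else x₀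
  have hG : Measurable G := by
    refine hF.comp (measurable_pi_iff.mpr fun i => ?_)
    by_cases hi : i ∈ S
    · simpa [hi] using measurable_pi_apply _
    · simp [hi]
  have hFG : ∀ ω, F ω = G (S.restrict ω) := fun ω => by
    rw [← hS ω]
    simp [G]
  -- `F` factors through the restriction to `S`, where the marginal of the mixed product is that of
  -- the full product of `μ'`.
  have e : ∫ ω, F ω ∂Measure.infinitePi (fun _ : ι => μ') =
      ∫ ω, F ω ∂Measure.infinitePi (fun i => if i ∈ S then μ' else μ) := by
    simp only [hFG]
    rw [integral_restrict_infinitePi _ hG.aestronglyMeasurable,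
      integral_restrict_infinitePi _ hG.aestronglyMeasurable]
    congr 2
    ext1 i
    simp
  rw [e]
  exact abs_integral_infinitePi_sub_le μ μ' hF hB h S

end ProductMeasure

/-! ### Locality and Lipschitz dependence of matrix elements on the potential -/

theorem abs_re_inner_delta_le {d : ℕ} (A : EllTwo d →L[ℂ] EllTwo d) (x : Site d) :
    |(inner ℂ (delta x) (A (delta x))).re| ≤ ‖A‖ := by
  refine (Complex.abs_re_le_norm _).trans ((norm_inner_le_norm _ _).trans ?_)
  rw [norm_delta, one_mul]
  exact (ContinuousLinearMap.le_opNorm _ _).trans_eq (by rw [norm_delta, mul_one])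

theorem norm_hamiltonian_sub_le {d K : ℕ} {C : ℝ} {ω ω' : Config d C} {M : ℝ}
    (h : ∀ k, |(ω k : ℝ) - ω' k| ≤ M) :
    ‖hamiltonian d K C ω - hamiltonian d K C ω'‖ ≤ M := by
  have hM : 0 ≤ M := (abs_nonneg _).trans (h 0)
  have e : hamiltonian d K C ω - hamiltonian d K C ω' =
      multiplication (fun x => (ω (cellCorner K x) : ℝ) - ω' (cellCorner K x)) M
        (fun x => h _) := by
    rw [hamiltonian, hamiltonian, add_sub_add_left_eq_sub]
    ext ψ x
    have : (potential d K C ω - potential d K C ω') ψ x =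
      (ω (cellCorner K x) : ℝ) * ψ x - (ω' (cellCorner K x) : ℝ) * ψ x := rfl
    rw [this, multiplication_apply]
    push_cast
    ring
  rw [e]
  unfold multiplication
  exact LinearMap.mkContinuous_norm_le _ hM _

/-- The sites at `ℓ^∞` distance at most `n` from `x`. -/
def siteBall {d : ℕ} (x : Site d) (n : ℕ) : Finset (Site d) :=
  Fintype.piFinset fun i => Finset.Icc (x i - n) (x i + n)

theorem card_siteBall {d : ℕ} (x : Site d) (n : ℕ) : (siteBall x n).card = (2 * n + 1) ^ d := by
  rw [siteBall, Fintype.card_piFinset]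
  have : ∀ i : Fin d, (Finset.Icc (x i - n) (x i + n)).card = 2 * n + 1 := fun i => by
    rw [Int.card_Icc]; omega
  simp [this]

theorem hamiltonian_apply {d K : ℕ} {C : ℝ} (ω : Config d C) (ψ : EllTwo d) (x : Site d) :
    hamiltonian d K C ω ψ x =
      (∑ i : Fin d, (ψ (x - Pi.single i 1) + ψ (x - -Pi.single i 1))) +
        ((ω (cellCorner K x) : ℝ) : ℂ) * ψ x := by
  rw [← inner_delta x (hamiltonian d K C ω ψ), hamiltonian, laplacian]
  simp only [_root_.add_apply, _root_.sum_apply, inner_add_right,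
    inner_sum, inner_delta, translation_apply]
  rfl

/-- One hop of the Laplacian enlarges the support radius by one; `s` covers both directions `±1`. -/
theorem mem_siteBall_succ {d : ℕ} {x y : Site d} {n : ℕ} (i : Fin d) {s : ℤ} (hs : |s| ≤ 1)
    (h : y - Pi.single i s ∈ siteBall x n) : y ∈ siteBall x (n + 1) := by
  simp only [siteBall, Fintype.mem_piFinset, Finset.mem_Icc, Pi.sub_apply] at h ⊢
  intro j
  have := h j
  rw [abs_le] at hs
  by_cases hj : j = i
  · subst hj
    rw [Pi.single_eq_same] at this
    push_cast; omega
  · rw [Pi.single_eq_of_ne hj] at this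
    push_cast; omega

/-- `H_ω^n δ_x` is supported in the ball of radius `n`, and depends on the potential in this ball
only. -/
theorem hamiltonian_pow_delta_local {d K : ℕ} {C : ℝ} {ω ω' : Config d C} (x : Site d) (m : ℕ)
    (h : ∀ y ∈ siteBall x m, ω (cellCorner K y) = ω' (cellCorner K y)) (n : ℕ) (hn : n ≤ m) :
    (∀ y, y ∉ siteBall x n → (hamiltonian d K C ω ^ n) (delta x) y = 0) ∧
      (hamiltonian d K C ω ^ n) (delta x) = (hamiltonian d K C ω' ^ n) (delta x) := by
  induction n with
  | zero =>
    refine ⟨fun y hy => ?_, by simp⟩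
    have hxy : y ≠ x := by
      rintro rfl
      exact hy (by simp [siteBall])
    exact lp.single_apply_ne (E := fun _ : Site d => ℂ) 2 x (1 : ℂ) hxy
  | succ n ih =>
    obtain ⟨h0, he⟩ := ih (by omega)
    have hmono : ∀ y, y ∈ siteBall x n → y ∈ siteBall x (n + 1) ∧ y ∈ siteBall x m := by
      intro y hy
      simp only [siteBall, Fintype.mem_piFinset, Finset.mem_Icc] at hy ⊢
      constructor <;> intro i <;> have := hy i
      · push_cast; omega
      · have : (n : ℤ) ≤ m := by exact_mod_cast (by omega : n ≤ m)
        omega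
    rw [pow_succ', pow_succ']
    constructor
    · intro y hy
      refine (hamiltonian_apply ω ((hamiltonian d K C ω ^ n) (delta x)) y).trans ?_
      rw [h0 y fun hy' => hy (hmono y hy').1, mul_zero, add_zero]
      refine Finset.sum_eq_zero fun i _ => ?_
      rw [h0 _ fun hy' => hy (mem_siteBall_succ i (by simp) hy'),
        h0 _ fun hy' => hy (mem_siteBall_succ i (s := -1) (by simp)
          (by rwa [Pi.single_neg])), add_zero]
    · change hamiltonian d K C ω ((hamiltonian d K C ω ^ n) (delta x)) =
        hamiltonian d K C ω' ((hamiltonian d K C ω' ^ n) (delta x))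
      rw [← he]
      ext y
      rw [hamiltonian_apply, hamiltonian_apply]
      -- Inside the ball the potentials agree; outside it the vector vanishes, so their values there
      -- are irrelevant.
      by_cases hy : y ∈ siteBall x n
      · rw [h y (hmono y hy).2]
      · rw [h0 y hy, mul_zero, mul_zero]

/-- Diagonal matrix elements of polynomials of `H_ω` depend on finitely many coordinates of `ω`. -/
theorem inner_cfc_polynomial_local {d K : ℕ} {C : ℝ} {ω ω' : Config d C} (x : Site d) (m : ℕ)
    (h : ∀ y ∈ siteBall x m, ω (cellCorner K y) = ω' (cellCorner K y)) (p : Polynomial ℝ)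
    (hp : p.natDegree ≤ m) :
    cfc (fun y => p.eval y) (hamiltonian d K C ω) (delta x) =
      cfc (fun y => p.eval y) (hamiltonian d K C ω') (delta x) := by
  rw [cfc_polynomial p _ (isSelfAdjoint_hamiltonian ω),
    cfc_polynomial p _ (isSelfAdjoint_hamiltonian ω'), Polynomial.aeval_eq_sum_range,
    Polynomial.aeval_eq_sum_range]
  simp only [_root_.sum_apply, _root_.smul_apply]
  refine Finset.sum_congr rfl fun n hn => ?_
  rw [(hamiltonian_pow_delta_local x m h n (by have := Finset.mem_range.mp hn; omega)).2]

/-- Changing the potential far away from `x` has little effect on `⟨δ_x, cos (t H_ω + φ) δ_x⟩`. -/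
theorem abs_inner_cos_sub_le_of_eq_on_siteBall {d K : ℕ} {C : ℝ} {ω ω' : Config d C} (x : Site d)
    (t φ : ℝ) (m : ℕ) (hm : 0 < m) (hsmall : |t| * (2 * d + C) / (m + 1) ≤ 1 / 2)
    (h : ∀ y ∈ siteBall x m, ω (cellCorner K y) = ω' (cellCorner K y)) :
    |(inner ℂ (delta x) (cfc (fun E : ℝ => Real.cos (t * E + φ)) (hamiltonian d K C ω)
        (delta x))).re -
      (inner ℂ (delta x) (cfc (fun E : ℝ => Real.cos (t * E + φ)) (hamiltonian d K C ω')
        (delta x))).re| ≤ 4 * ((|t| * (2 * d + C)) ^ m / m.factorial) := by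
  have hC : 0 ≤ C := (abs_nonneg _).trans (abs_le.mpr (ω 0).2)
  obtain ⟨p, hp, happ⟩ := exists_polynomial_cos_approx t φ (2 * d + C) m hm hsmall
  have key : ∀ ω : Config d C,
      |(inner ℂ (delta x) (cfc (fun E : ℝ => Real.cos (t * E + φ)) (hamiltonian d K C ω)
        (delta x))).re -
        (inner ℂ (delta x) (cfc (fun y => p.eval y) (hamiltonian d K C ω) (delta x))).re| ≤
      (|t| * (2 * d + C)) ^ m / m.factorial * 2 := by
    intro ω
    rw [← Complex.sub_re, ← inner_sub_right, ← _root_.sub_apply, ← cfc_sub _ _ _ (by fun_prop)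
      p.continuous.continuousOn]
    refine (abs_re_inner_delta_le _ _).trans (norm_cfc_le (by positivity) fun E hE => ?_)
    exact happ E (abs_le.mpr (spectrum_hamiltonian_subset ω hE))
  have h1 := key ω
  have h2 := key ω'
  rw [inner_cfc_polynomial_local x m h p hp.le] at h1
  rw [abs_le] at *
  constructor <;> linarith [h1.1, h1.2, h2.1, h2.2]

/-- Lipschitz continuity of `ω_k ↦ ⟨δ_x, cos (t H_ω + φ) δ_x⟩`. -/
theorem abs_inner_cos_update_sub_le {d K : ℕ} {C : ℝ} (ω : Config d C) (k x : Site d)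
    (t φ : ℝ) (a b : Icc (-C) C) :
    |(inner ℂ (delta x) (cfc (fun E : ℝ => Real.cos (t * E + φ))
        (hamiltonian d K C (Function.update ω k a)) (delta x))).re -
      (inner ℂ (delta x) (cfc (fun E : ℝ => Real.cos (t * E + φ))
        (hamiltonian d K C (Function.update ω k b)) (delta x))).re| ≤ |t| * |(a : ℝ) - b| := by
  rw [← Complex.sub_re, ← inner_sub_right, ← _root_.sub_apply]
  refine (abs_re_inner_delta_le _ _).trans ((norm_cfc_cos_sub_cfc_cos_le
    (isSelfAdjoint_hamiltonian _) (isSelfAdjoint_hamiltonian _) t φ).trans ?_)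
  gcongr
  refine norm_hamiltonian_sub_le fun j => ?_
  by_cases hj : j = k
  · subst hj; simp
  · simp [hj]
/-! ### The metric `d_w` -/

theorem nonempty_Icc_of_probabilityMeasure {C : ℝ} (μ : ProbabilityMeasure (Icc (-C) C)) :
    Nonempty (Icc (-C) C) :=
  (μ : Measure (Icc (-C) C)).nonempty_of_neZero

theorem lipNorm_le {C : ℝ} [Nonempty (Icc (-C) C)] {f : Icc (-C) C → ℝ} {A L : ℝ} (hL : 0 ≤ L)
    (hA : ∀ x, |f x| ≤ A) (hf : ∀ x y, |f x - f y| ≤ L * |(x : ℝ) - y|) : lipNorm f ≤ A + L := by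
  refine add_le_add (ciSup_le hA) (ciSup_le fun p => ?_)
  exact div_le_of_le_mul₀ (abs_nonneg _) hL (hf _ _)

theorem lipschitzWith_of_abs_le {C : ℝ} {f : Icc (-C) C → ℝ} {L : ℝ} (hL : 0 ≤ L)
    (hf : ∀ x y, |f x - f y| ≤ L * |(x : ℝ) - y|) : LipschitzWith ⟨L, hL⟩ f :=
  LipschitzWith.of_dist_le_mul fun x y => by
    rw [Real.dist_eq, Subtype.dist_eq, Real.dist_eq]; exact hf x y

/-- Lipschitz continuity bounds both families in `lipNorm`. Without it a real supremum could take
its default value 0 and the norm bound would carry no information. -/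
theorem abs_le_of_lipNorm_le_one {C : ℝ} {f : Icc (-C) C → ℝ} {L : NNReal}
    (hL : LipschitzWith L f) (hf : lipNorm f ≤ 1) :
    (∀ x, |f x| ≤ 1) ∧ ∀ x y, |f x - f y| ≤ |(x : ℝ) - y| := by
  have hb1 : BddAbove (range fun x => |f x|) := by
    have := isCompact_range (continuous_abs.comp hL.continuous)
    exact this.bddAbove
  have hb2 : BddAbove (range fun p : Icc (-C) C × Icc (-C) C =>
      |f p.1 - f p.2| / |(p.1 : ℝ) - (p.2 : ℝ)|) := by
    refine ⟨L, ?_⟩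
    rintro _ ⟨p, rfl⟩
    refine div_le_of_le_mul₀ (abs_nonneg _) L.2 ?_
    have := hL.dist_le_mul p.1 p.2
    rwa [Real.dist_eq, Subtype.dist_eq, Real.dist_eq] at this
  have h1 : 0 ≤ ⨆ x, |f x| := Real.iSup_nonneg fun x => abs_nonneg _
  have h2 : 0 ≤ ⨆ p : Icc (-C) C × Icc (-C) C, |f p.1 - f p.2| / |(p.1 : ℝ) - (p.2 : ℝ)| :=
    Real.iSup_nonneg fun x => by positivity
  unfold lipNorm at hf
  refine ⟨fun x => (le_ciSup hb1 x).trans (by linarith), fun x y => ?_⟩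
  rcases eq_or_ne x y with rfl | hxy
  · simp
  have hpos : 0 < |(x : ℝ) - y| := abs_pos.mpr (sub_ne_zero.mpr fun h => hxy (Subtype.ext h))
  have := (le_ciSup hb2 (x, y)).trans (by linarith : _ ≤ (1 : ℝ))
  simpa using (div_le_iff₀ hpos).mp this

theorem distW_nonneg {C : ℝ} (μ ν : ProbabilityMeasure (Icc (-C) C)) : 0 ≤ distW μ ν := by
  refine Real.sSup_nonneg ?_
  rintro _ ⟨f, -, -, rfl⟩
  exact abs_nonneg _

theorem abs_integral_le_of_abs_le {X : Type*} [MeasurableSpace X] (μ : Measure X)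
    [IsProbabilityMeasure μ] {f : X → ℝ} {B : ℝ} (h : ∀ x, |f x| ≤ B) : |∫ x, f x ∂μ| ≤ B := by
  rw [← Real.norm_eq_abs]
  refine (norm_integral_le_of_norm_le_const (C := B) (Eventually.of_forall h)).trans_eq ?_
  rw [probReal_univ, mul_one]

/-- By homogeneity: `f / (A + L)` is an admissible test function for `d_w`. -/
theorem abs_integral_sub_le_distW {C : ℝ} (μ ν : ProbabilityMeasure (Icc (-C) C))
    {f : Icc (-C) C → ℝ} {A L : ℝ} (hApos : 0 < A) (hL : 0 ≤ L) (hA : ∀ x, |f x| ≤ A)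
    (hf : ∀ x y, |f x - f y| ≤ L * |(x : ℝ) - y|) :
    |∫ x, f x ∂(μ : Measure (Icc (-C) C)) - ∫ x, f x ∂(ν : Measure (Icc (-C) C))| ≤
      (A + L) * distW μ ν := by
  have := nonempty_Icc_of_probabilityMeasure μ
  have hpos : 0 < A + L := by positivity
  set g : Icc (-C) C → ℝ := fun x => (A + L)⁻¹ * f x with hg
  have hgA : ∀ x, |g x| ≤ (A + L)⁻¹ * A := fun x => by
    rw [hg, abs_mul, abs_of_pos (inv_pos.mpr hpos)]
    exact mul_le_mul_of_nonneg_left (hA x) (by positivity)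
  have hgL : ∀ x y, |g x - g y| ≤ (A + L)⁻¹ * L * |(x : ℝ) - y| := fun x y => by
    rw [hg, ← mul_sub, abs_mul, abs_of_pos (inv_pos.mpr hpos), mul_assoc]
    exact mul_le_mul_of_nonneg_left (hf x y) (by positivity)
  -- Needed for the supremum to dominate its members; test functions are bounded by 1, so 2 is an
  -- upper bound.
  have hbdd : BddAbove {t : ℝ | ∃ f : Icc (-C) C → ℝ, (∃ L, LipschitzWith L f) ∧ lipNorm f ≤ 1 ∧
      t = |(∫ x, f x ∂(μ : Measure (Icc (-C) C))) - ∫ x, f x ∂(ν : Measure (Icc (-C) C))|} := by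
    refine ⟨2, ?_⟩
    rintro _ ⟨f, ⟨L, hL⟩, hf, rfl⟩
    have h1 := (abs_le_of_lipNorm_le_one hL hf).1
    refine (abs_sub _ _).trans ?_
    linarith [abs_integral_le_of_abs_le (μ : Measure (Icc (-C) C)) h1,
      abs_integral_le_of_abs_le (ν : Measure (Icc (-C) C)) h1]
  have key := le_csSup hbdd ⟨g, ⟨_, lipschitzWith_of_abs_le (by positivity) hgL⟩,
    (lipNorm_le (by positivity) hgA hgL).trans_eq
      (by rw [← mul_add, inv_mul_cancel₀ hpos.ne']), rfl⟩
  rw [hg, integral_const_mul, integral_const_mul, ← mul_sub, abs_mul,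
    abs_of_pos (inv_pos.mpr hpos), inv_mul_le_iff₀ hpos] at key
  exact key

/-- Weak convergence implies convergence in the metric `d_w`. -/
theorem tendsto_distW {C : ℝ} {νs : ℕ → ProbabilityMeasure (Icc (-C) C)}
    {ν : ProbabilityMeasure (Icc (-C) C)} (h : Tendsto νs atTop (𝓝 ν)) :
    Tendsto (fun α => distW (νs α) ν) atTop (𝓝 0) := by
  rw [ProbabilityMeasure.tendsto_iff_forall_integral_tendsto] at h
  rw [Metric.tendsto_atTop]
  intro δ hδ
  -- Uniformity over test functions comes from a partition of unity `φ i` with supports in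
  -- `δ/4`-balls: every admissible `f` is uniformly `δ/4`-close to `∑ f (c i) φ i`, so the finitely
  -- many `φ i` suffice.
  obtain ⟨s, -, hsfin, hs⟩ := finite_cover_balls_of_compact (isCompact_univ (X := Icc (-C) C))
    (by positivity : 0 < δ / 4)
  obtain ⟨n, c, rfl⟩ : ∃ n, ∃ c : Fin n → Icc (-C) C, s = range c := by
    have := hsfin.to_subtype
    obtain ⟨n, ⟨e⟩⟩ := Finite.exists_equiv_fin s
    exact ⟨n, fun i => (e.symm i : Icc (-C) C), by
      rw [show (fun i => (e.symm i : Icc (-C) C)) = Subtype.val ∘ e.symm from rfl, range_comp,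
        e.symm.surjective.range_eq, image_univ, Subtype.range_coe]⟩
  obtain ⟨φ, hφs, hφ1, hφ0, -⟩ := exists_continuous_sum_one_of_isOpen_isCompact
    (s := fun i : Fin n => Metric.ball (c i) (δ / 4)) (fun i => Metric.isOpen_ball)
    isCompact_univ (by rwa [biUnion_range] at hs)
  have hsum : Tendsto (fun α => ∑ i, |∫ x, φ i x ∂(νs α : Measure (Icc (-C) C)) -
      ∫ x, φ i x ∂(ν : Measure (Icc (-C) C))|) atTop (𝓝 0) := by
    rw [← Finset.sum_const_zero (s := (Finset.univ : Finset (Fin n))) (M := ℝ)]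
    refine tendsto_finsetSum _ fun i _ => ?_
    have := (h (BoundedContinuousFunction.mkOfCompact (φ i))).sub_const
      (∫ x, φ i x ∂(ν : Measure (Icc (-C) C)))
    simpa using this.abs
  obtain ⟨N, hN⟩ := Metric.tendsto_atTop.mp hsum (δ / 4) (by positivity)
  refine ⟨N, fun α hα => ?_⟩
  have hNα := hN α hα
  rw [Real.dist_eq, sub_zero] at hNα ⊢
  rw [abs_of_nonneg (distW_nonneg _ _)]
  -- Two approximation errors and the finite-sum error, `δ/4` each; the spare quarter makes the
  -- inequality strict after taking the supremum.
  refine lt_of_le_of_lt (b := 3 * δ / 4) (Real.sSup_le ?_ (by positivity)) (by linarith)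
  rintro _ ⟨f, ⟨L, hL⟩, hf, rfl⟩
  obtain ⟨hf1, hfL⟩ := abs_le_of_lipNorm_le_one hL hf
  have happ : ∀ x, |f x - ∑ i, f (c i) * φ i x| ≤ δ / 4 := by
    intro x
    have h1 : ∑ i, φ i x = 1 := by simpa using hφ1 (mem_univ x)
    have e : f x - ∑ i, f (c i) * φ i x = ∑ i, (f x - f (c i)) * φ i x := by
      simp only [sub_mul, Finset.sum_sub_distrib, ← Finset.mul_sum, h1, mul_one]
    rw [e]
    refine (Finset.abs_sum_le_sum_abs _ _).trans ?_
    rw [← mul_one (δ / 4), ← h1, Finset.mul_sum]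
    refine Finset.sum_le_sum fun i _ => ?_
    rw [abs_mul, abs_of_nonneg (hφ0 i x).1]
    by_cases hx : φ i x = 0
    · simp [hx]
    · have hxs : x ∈ Metric.ball (c i) (δ / 4) := hφs i (subset_tsupport _ hx)
      refine mul_le_mul_of_nonneg_right ((hfL _ _).trans ?_) (hφ0 i x).1
      rw [Metric.mem_ball, Subtype.dist_eq, Real.dist_eq] at hxs
      exact hxs.le
  have hint : ∀ (m : ProbabilityMeasure (Icc (-C) C)) {g : Icc (-C) C → ℝ}, Continuous g →
      Integrable g (m : Measure (Icc (-C) C)) := fun m g hg =>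
    hg.integrable_of_hasCompactSupport (HasCompactSupport.of_compactSpace _)
  have hcont : Continuous fun x => ∑ i, f (c i) * φ i x := by fun_prop
  have hm : ∀ m : ProbabilityMeasure (Icc (-C) C),
      |∫ x, f x ∂(m : Measure (Icc (-C) C)) -
        ∑ i, f (c i) * ∫ x, φ i x ∂(m : Measure (Icc (-C) C))| ≤ δ / 4 := by
    intro m
    have e : ∑ i, f (c i) * ∫ x, φ i x ∂(m : Measure (Icc (-C) C)) =
        ∫ x, ∑ i, f (c i) * φ i x ∂(m : Measure (Icc (-C) C)) := by
      rw [integral_finsetSum _ fun i _ => hint m (by fun_prop)]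
      simp only [integral_const_mul]
    rw [e, ← integral_sub (hint m hL.continuous) (hint m hcont)]
    exact abs_integral_le_of_abs_le _ happ
  have hmid : |∑ i, f (c i) * ∫ x, φ i x ∂(νs α : Measure (Icc (-C) C)) -
      ∑ i, f (c i) * ∫ x, φ i x ∂(ν : Measure (Icc (-C) C))| ≤ δ / 4 := by
    rw [← Finset.sum_sub_distrib]
    refine (Finset.abs_sum_le_sum_abs _ _).trans (le_trans ?_ ((le_abs_self _).trans hNα.le))
    refine Finset.sum_le_sum fun i _ => ?_
    rw [← mul_sub, abs_mul]
    exact mul_le_of_le_one_left (abs_nonneg _) (hf1 _)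
  have h1 := hm (νs α)
  have h2 := hm ν
  rw [abs_le] at *
  constructor <;> linarith [h1.1, h1.2, h2.1, h2.2, hmid.1, hmid.2]

/-! ### Integrals with respect to the density of states measure -/

theorem card_cube (d K : ℕ) : (cube d K).card = K ^ d := by
  simp [cube, Fintype.card_piFinset]

theorem abs_localTrace_le {d K : ℕ} {C : ℝ} {f : ℝ → ℝ} {B : ℝ} (hB : 0 ≤ B)
    (hf : ∀ y, |f y| ≤ B) (ω : Config d C) : |localTrace d K C f ω| ≤ (K : ℝ) ^ d * B := by
  rw [localTrace_eq_sum]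
  refine (Finset.abs_sum_le_sum_abs _ _).trans ?_
  refine (Finset.sum_le_card_nsmul _ _ B fun x _ => ?_).trans_eq (by simp [card_cube])
  exact (abs_re_inner_delta_le _ x).trans (norm_cfc_le hB fun y _ => hf y)

/-- The cutoff equal to `1` on `[-R, R]` and `0` off `[-R-1, R+1]`. -/
def cutoff (R x : ℝ) : ℝ := max 0 (min 1 (R + 1 - |x|))

theorem continuous_cutoff (R : ℝ) : Continuous (cutoff R) := by
  unfold cutoff; fun_prop

theorem cutoff_nonneg (R x : ℝ) : 0 ≤ cutoff R x := le_max_left _ _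

theorem cutoff_le_one (R x : ℝ) : cutoff R x ≤ 1 := max_le zero_le_one (min_le_left _ _)

theorem cutoff_eq_one {R x : ℝ} (h : |x| ≤ R) : cutoff R x = 1 := by
  rw [cutoff, min_eq_left (by linarith), max_eq_right zero_le_one]

theorem hasCompactSupport_cutoff (R : ℝ) : HasCompactSupport (cutoff R) := by
  refine HasCompactSupport.intro (isCompact_Icc (a := -(R + 1)) (b := R + 1)) fun x hx => ?_
  have : R + 1 < |x| := by
    by_contra! h
    exact hx (abs_le.mp h)
  rw [cutoff, max_eq_left]
  exact (min_le_right _ _).trans (by linarith)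

/-- The product of a continuous function with a cutoff. -/
def cutoffMul (f : ℝ → ℝ) (hf : Continuous f) (R : ℝ) : C_c(ℝ, ℝ) where
  toFun := fun x => cutoff R x * f x
  continuous_toFun := (continuous_cutoff R).mul hf
  hasCompactSupport' := (hasCompactSupport_cutoff R).mul_right

/-- The spectrum of every `H_ω` lies in `[-r, r]`, where the cutoff equals 1, so the functional
calculus does not see it. -/
theorem integral_cutoffMul_dosMeasure {d K : ℕ} {C : ℝ} (ν : ProbabilityMeasure (Icc (-C) C))
    {f : ℝ → ℝ} (hf : Continuous f) {R : ℝ} (hR : 2 * d + C ≤ R) :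
    ∫ E, cutoff R E * f E ∂(dosMeasure d K ν) =
      ((K : ℝ) ^ d)⁻¹ * ∫ ω, localTrace d K C f ω ∂(productLaw d ν) := by
  refine (integral_dosMeasure d K ν (cutoffMul f hf R)).trans ?_
  congr 2
  ext ω
  rw [localTrace_eq_sum, localTrace_eq_sum]
  refine Finset.sum_congr rfl fun x _ => ?_
  have : cfc (cutoffMul f hf R) (hamiltonian d K C ω) = cfc f (hamiltonian d K C ω) := by
    refine cfc_congr fun y hy => ?_
    change cutoff R y * f y = f y
    rw [cutoff_eq_one, one_mul]
    exact (abs_le.mpr (spectrum_hamiltonian_subset ω hy)).trans hR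
  rw [this]

/-- Finite mass is what allows the defining identity to pass from `C_c` to bounded functions such as
cosines. Mass at most one follows by testing with cutoffs and exhausting the line. -/
theorem dosMeasure_univ_le_one (d K : ℕ) {C : ℝ} (ν : ProbabilityMeasure (Icc (-C) C)) :
    dosMeasure d K ν univ ≤ 1 := by
  have hreg : (dosMeasure d K ν).Regular := RealRMK.regular_rieszMeasure _
  have hR : ∀ R : ℝ, 2 * d + C ≤ R → dosMeasure d K ν (Icc (-R) R) ≤ 1 := by
    intro R hR
    have hint : Integrable (cutoff R) (dosMeasure d K ν) :=
      (continuous_cutoff R).integrable_of_hasCompactSupport (hasCompactSupport_cutoff R)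
    have h1 : ∫ E, cutoff R E ∂(dosMeasure d K ν) ≤ 1 := by
      have := integral_cutoffMul_dosMeasure (K := K) ν (f := fun _ => 1) continuous_const hR
      simp only [mul_one] at this
      rw [this]
      refine inv_mul_le_of_le_mul₀ (by positivity) zero_le_one ?_
      exact (le_abs_self _).trans
        (abs_integral_le_of_abs_le _ fun ω => abs_localTrace_le zero_le_one (by simp) ω)
    calc dosMeasure d K ν (Icc (-R) R)
        = ∫⁻ E, (Icc (-R) R).indicator 1 E ∂(dosMeasure d K ν) := by
          rw [lintegral_indicator_one measurableSet_Icc]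
      _ ≤ ∫⁻ E, ENNReal.ofReal (cutoff R E) ∂(dosMeasure d K ν) := by
          refine lintegral_mono fun E => ?_
          by_cases hE : E ∈ Icc (-R) R
          · rw [cutoff_eq_one (abs_le.mpr hE)]; simp [hE]
          · simp [hE]
      _ = ENNReal.ofReal (∫ E, cutoff R E ∂(dosMeasure d K ν)) :=
          (ofReal_integral_eq_lintegral_ofReal hint
            (Eventually.of_forall (cutoff_nonneg R))).symm
      _ ≤ 1 := ENNReal.ofReal_le_one.mpr h1
  have hmono : Monotone fun n : ℕ => Icc (-(n : ℝ)) n := fun m n hmn =>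
    Icc_subset_Icc (by simpa using hmn) (by simpa using hmn)
  have hU : ⋃ n : ℕ, Icc (-(n : ℝ)) n = univ := by
    refine eq_univ_of_forall fun x => ?_
    obtain ⟨n, hn⟩ := exists_nat_ge |x|
    exact mem_iUnion.mpr ⟨n, abs_le.mp hn⟩
  have hlim := tendsto_measure_iUnion_atTop (μ := dosMeasure d K ν) hmono
  rw [hU] at hlim
  refine le_of_tendsto hlim ?_
  obtain ⟨n₀, hn₀⟩ := exists_nat_ge (2 * d + C)
  filter_upwards [eventually_ge_atTop n₀] with n hn
  exact hR n (hn₀.trans (by exact_mod_cast hn))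

instance isFiniteMeasure_dosMeasure (d K : ℕ) {C : ℝ} (ν : ProbabilityMeasure (Icc (-C) C)) :
    IsFiniteMeasure (dosMeasure d K ν) :=
  ⟨(dosMeasure_univ_le_one d K ν).trans_lt ENNReal.one_lt_top⟩

/-- The density of states measure integrates all bounded continuous functions as expected. -/
theorem integral_dosMeasure_of_bounded (d K : ℕ) {C : ℝ} (ν : ProbabilityMeasure (Icc (-C) C))
    {f : ℝ → ℝ} (hf : Continuous f) {B : ℝ} (hB : ∀ x, |f x| ≤ B) :
    ∫ E, f E ∂(dosMeasure d K ν) =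
      ((K : ℝ) ^ d)⁻¹ * ∫ ω, localTrace d K C f ω ∂(productLaw d ν) := by
  have hlim : Tendsto (fun n : ℕ => ∫ E, cutoff n E * f E ∂(dosMeasure d K ν)) atTop
      (𝓝 (∫ E, f E ∂(dosMeasure d K ν))) := by
    refine tendsto_integral_of_dominated_convergence (fun _ => B)
      (fun n => ((continuous_cutoff n).mul hf).aestronglyMeasurable) (integrable_const _)
      (fun n => Eventually.of_forall fun E => ?_) (Eventually.of_forall fun E => ?_)
    · rw [norm_mul, Real.norm_of_nonneg (cutoff_nonneg _ _), Real.norm_eq_abs]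
      exact (mul_le_of_le_one_left (abs_nonneg _) (cutoff_le_one _ _)).trans (hB E)
    · obtain ⟨n₀, hn₀⟩ := exists_nat_ge |E|
      refine tendsto_const_nhds.congr' ?_
      filter_upwards [eventually_ge_atTop n₀] with n hn
      rw [cutoff_eq_one (hn₀.trans (by exact_mod_cast hn)), one_mul]
  refine tendsto_nhds_unique hlim (tendsto_const_nhds.congr' ?_)
  obtain ⟨n₀, hn₀⟩ := exists_nat_ge (2 * d + C)
  filter_upwards [eventually_ge_atTop n₀] with n hn
  exact (integral_cutoffMul_dosMeasure ν hf (hn₀.trans (by exact_mod_cast hn))).symm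

/-! ### Dependence of the density of states measure on the single-site law -/

/-- The diagonal matrix element `⟨δ_x, cos (t H_ω + φ) δ_x⟩`. -/
def cosElement (d K : ℕ) (C t φ : ℝ) (x : Site d) (ω : Config d C) : ℝ :=
  (inner ℂ (delta x) (cfc (fun E : ℝ => Real.cos (t * E + φ)) (hamiltonian d K C ω)
    (delta x))).re

theorem continuous_cosElement {d K : ℕ} {C : ℝ} (t φ : ℝ) (x : Site d) :
    Continuous (cosElement d K C t φ x) :=
  Complex.continuous_re.comp (continuous_inner_cfc (by fun_prop) x)

theorem abs_cosElement_le {d K : ℕ} {C : ℝ} (t φ : ℝ) (x : Site d) (ω : Config d C) :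
    |cosElement d K C t φ x ω| ≤ 1 :=
  (abs_re_inner_delta_le _ x).trans (norm_cfc_cos_le _ t φ)

/-- Freezing the coordinates of all cells missing the radius-`m` ball costs one Taylor error `4 (…)`
under each of the two laws, hence the 8. The frozen function sees at most `(2m+1)^d` coordinates,
each exchanged at cost `(1 + |t|) d_w`. -/
theorem abs_integral_cosElement_sub_le {d K : ℕ} {C : ℝ}
    (μ ν : ProbabilityMeasure (Icc (-C) C)) (t φ : ℝ) (x : Site d) (m : ℕ) (hm : 0 < m)
    (hsmall : |t| * (2 * d + C) / (m + 1) ≤ 1 / 2) :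
    |∫ ω, cosElement d K C t φ x ω ∂(productLaw d μ) -
      ∫ ω, cosElement d K C t φ x ω ∂(productLaw d ν)| ≤
      8 * ((|t| * (2 * d + C)) ^ m / m.factorial) +
        (2 * m + 1) ^ d * ((1 + |t|) * distW μ ν) := by
  obtain ⟨x₀⟩ := nonempty_Icc_of_probabilityMeasure μ
  set S : Finset (Site d) := (siteBall x m).image (cellCorner K) with hS
  let τ : Config d C → Config d C := fun ω i => if i ∈ S then ω i else x₀
  have hτ : Continuous τ := by
    refine continuous_pi fun i => ?_
    by_cases hi : i ∈ S
    · simpa [τ, hi] using continuous_apply i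
    · simpa [τ, hi] using continuous_const
  have hFc : Continuous (cosElement d K C t φ x ∘ τ) := (continuous_cosElement t φ x).comp hτ
  have hclose : ∀ ω, |cosElement d K C t φ x ω - cosElement d K C t φ x (τ ω)| ≤
      4 * ((|t| * (2 * d + C)) ^ m / m.factorial) := fun ω =>
    abs_inner_cos_sub_le_of_eq_on_siteBall x t φ m hm hsmall fun y hy => by
      have hy' : cellCorner K y ∈ S := Finset.mem_image_of_mem (cellCorner K) hy
      simp [τ, hy']
  have hint : ∀ (κ : ProbabilityMeasure (Icc (-C) C)) {g : Config d C → ℝ}, Continuous g →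
      Integrable g (productLaw d κ) := fun κ g hg =>
    hg.integrable_of_hasCompactSupport (HasCompactSupport.of_compactSpace _)
  have hrepl : ∀ κ : ProbabilityMeasure (Icc (-C) C),
      |∫ ω, cosElement d K C t φ x ω ∂(productLaw d κ) -
        ∫ ω, (cosElement d K C t φ x ∘ τ) ω ∂(productLaw d κ)| ≤
        4 * ((|t| * (2 * d + C)) ^ m / m.factorial) := fun κ => by
    rw [← integral_sub (hint κ (continuous_cosElement t φ x)) (hint κ hFc)]
    exact abs_integral_le_of_abs_le _ hclose
  have hcard : (S.card : ℝ) ≤ (2 * m + 1) ^ d := by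
    have : S.card ≤ (2 * m + 1) ^ d := Finset.card_image_le.trans_eq (card_siteBall x m)
    exact_mod_cast this
  have hmid := abs_integral_infinitePi_sub_le_of_dependsOn (ν : Measure (Icc (-C) C))
    (μ : Measure (Icc (-C) C)) (F := cosElement d K C t φ x ∘ τ) (B := 1)
    (δ := (1 + |t|) * distW μ ν) hFc.measurable (fun ω => abs_cosElement_le _ _ _ _)
    (fun k ω => abs_integral_sub_le_distW μ ν one_pos (abs_nonneg t)
      (fun y => abs_cosElement_le _ _ _ _) fun a b => by
        by_cases hk : k ∈ S
        · have e : ∀ a, τ (Function.update ω k a) = Function.update (τ ω) k a := fun a => by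
            ext1 i
            by_cases hi : i = k
            · subst hi; simp [τ, hk]
            · simp [τ, hi]
          simp only [Function.comp_apply, e]
          exact abs_inner_cos_update_sub_le _ _ _ _ _ _ _
        · have e : ∀ a, τ (Function.update ω k a) = τ ω := fun a => by
            ext1 i
            by_cases hi : i = k
            · subst hi; simp [τ, hk]
            · simp [τ, hi]
          simp only [Function.comp_apply, e, sub_self, abs_zero]
          positivity)
    S x₀ (fun ω => by
      simp only [Function.comp_apply]
      congr 1
      ext1 i
      by_cases hi : i ∈ S <;> simp [τ, hi])
  have hmid' := hmid.trans (mul_le_mul_of_nonneg_right hcard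
    (mul_nonneg (by positivity) (distW_nonneg μ ν)))
  have h1 := hrepl μ
  have h2 := hrepl ν
  unfold productLaw at *
  rw [abs_le] at *
  constructor <;> linarith [h1.1, h1.2, h2.1, h2.2, hmid'.1, hmid'.2]

theorem integral_cos_dosMeasure (d K : ℕ) {C : ℝ} (ν : ProbabilityMeasure (Icc (-C) C))
    (t φ : ℝ) : ∫ E, Real.cos (t * E + φ) ∂(dosMeasure d K ν) =
      ((K : ℝ) ^ d)⁻¹ * ∑ x ∈ cube d K, ∫ ω, cosElement d K C t φ x ω ∂(productLaw d ν) := by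
  rw [integral_dosMeasure_of_bounded d K ν (by fun_prop) (fun x => Real.abs_cos_le_one _)]
  simp only [localTrace_eq_sum]
  rw [integral_finsetSum]
  · rfl
  · exact fun x _ => (continuous_cosElement t φ x).integrable_of_hasCompactSupport
      (HasCompactSupport.of_compactSpace _)

theorem abs_integral_cos_dosMeasure_sub_le {d K : ℕ} {C : ℝ} {B : ℝ} (hB : 0 ≤ B)
    (μ ν : ProbabilityMeasure (Icc (-C) C)) (t φ : ℝ)
    (h : ∀ x : Site d, |∫ ω, cosElement d K C t φ x ω ∂(productLaw d μ) -
      ∫ ω, cosElement d K C t φ x ω ∂(productLaw d ν)| ≤ B) :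
    |∫ E, Real.cos (t * E + φ) ∂(dosMeasure d K μ) -
      ∫ E, Real.cos (t * E + φ) ∂(dosMeasure d K ν)| ≤ B := by
  rw [integral_cos_dosMeasure, integral_cos_dosMeasure, ← mul_sub, ← Finset.sum_sub_distrib,
    abs_mul, abs_of_nonneg (by positivity)]
  refine inv_mul_le_of_le_mul₀ (by positivity) hB ((Finset.abs_sum_le_sum_abs _ _).trans ?_)
  exact (Finset.sum_le_card_nsmul _ _ B fun x _ => h x).trans_eq (by simp [card_cube])

/-! ### Fourier inversion -/

section FourierInversion

open scoped FourierTransform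

/-- Fourier inversion almost everywhere. -/
theorem ae_eq_fourierInv_fourier {f : ℝ → ℂ} (hf : Integrable f) (hf' : Integrable (𝓕 f)) :
    f =ᵐ[volume] 𝓕⁻ (𝓕 f) := by
  have hswap : ∀ {g h : ℝ → ℂ}, Integrable g → Integrable h →
      ∫ ξ, 𝓕 g ξ * h ξ = ∫ x, g x * 𝓕 h x := fun {g h} hg hh => by
    simpa using! VectorFourier.integral_fourierIntegral_smul_eq_flip (L := innerₗ ℝ)
      Real.continuous_fourierChar continuous_inner hg hh
  have hcont : Continuous (𝓕⁻ (𝓕 f)) := by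
    rw [Real.fourierInv_eq_fourier_comp_neg]
    exact VectorFourier.fourierIntegral_continuous (L := innerₗ ℝ) Real.continuous_fourierChar
      continuous_inner hf'.comp_neg
  -- It suffices to test against smooth compactly supported `g`. There inversion is known for
  -- Schwartz functions, and `hswap` moves both transforms from `f` onto `g`.
  refine ae_eq_of_integral_contDiff_smul_eq hf.locallyIntegrable hcont.locallyIntegrable
    fun g hg hgs => ?_
  let G : SchwartzMap ℝ ℂ := HasCompactSupport.toSchwartzMap (f := fun x => (g x : ℂ))
    (hgs.comp_left Complex.ofReal_zero) (Complex.ofRealCLM.contDiff.comp hg)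
  have hG : ∀ x, G x = (g x : ℂ) := fun _ => rfl
  have e0 : 𝓕 (𝓕⁻ (G : ℝ → ℂ)) = G := by
    rw [← SchwartzMap.fourierInv_coe, ← SchwartzMap.fourier_coe]
    simp
  have hi : Integrable (𝓕⁻ (G : ℝ → ℂ)) := by
    rw [← SchwartzMap.fourierInv_coe]
    exact (𝓕⁻ G).integrable
  have e1 : ∫ x, f x * G x = ∫ x, 𝓕⁻ (𝓕 f) x * G x := by
    calc ∫ x, f x * G x = ∫ x, f x * 𝓕 (𝓕⁻ (G : ℝ → ℂ)) x := by rw [e0]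
      _ = ∫ x, 𝓕 f x * 𝓕⁻ (G : ℝ → ℂ) x := (hswap hf hi).symm
      _ = ∫ x, 𝓕 f (-x) * 𝓕⁻ (G : ℝ → ℂ) (-x) :=
          (integral_neg_eq_self (fun x => 𝓕 f x * 𝓕⁻ (G : ℝ → ℂ) x) volume).symm
      _ = ∫ x, 𝓕 f (-x) * 𝓕 (G : ℝ → ℂ) x := by
          simp only [Real.fourierInv_eq_fourier_neg, neg_neg]
      _ = ∫ x, 𝓕 (fun y => 𝓕 f (-y)) x * G x := (hswap hf'.comp_neg G.integrable).symm
      _ = _ := by rw [Real.fourierInv_eq_fourier_comp_neg (𝓕 f)]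
  simpa only [Complex.real_smul, hG, mul_comm] using e1

end FourierInversion

open scoped FourierTransform in
theorem fourierHat_two_pi_mul (g : ℝ → ℝ) (w : ℝ) :
    fourierHat g (2 * Real.pi * w) =
      ((Real.sqrt (2 * Real.pi))⁻¹ : ℝ) * 𝓕 (fun x => (g x : ℂ)) w := by
  rw [fourierHat, Real.fourier_real_eq_integral_exp_smul]
  congr 2
  ext E
  rw [smul_eq_mul]
  congr 2
  push_cast
  ring

/-- The inverse of `fourierHat`. -/
def fourierHatInv (h : ℝ → ℂ) (E : ℝ) : ℂ :=
  ((Real.sqrt (2 * Real.pi))⁻¹ : ℝ) * ∫ t : ℝ, Complex.exp (Complex.I * t * E) * h t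

theorem norm_exp_I_mul (t E : ℝ) : ‖Complex.exp (Complex.I * t * E)‖ = 1 := by
  rw [show Complex.I * t * E = ((t * E : ℝ) : ℂ) * Complex.I by push_cast; ring,
    Complex.norm_exp_ofReal_mul_I]

theorem norm_exp_neg_I_mul (t E : ℝ) : ‖Complex.exp (-(Complex.I * t * E))‖ = 1 := by
  rw [show -(Complex.I * t * E) = ((-(t * E) : ℝ) : ℂ) * Complex.I by push_cast; ring,
    Complex.norm_exp_ofReal_mul_I]

theorem integrable_exp_I_mul {h : ℝ → ℂ} (hh : Integrable h) (E : ℝ) :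
    Integrable fun t : ℝ => Complex.exp (Complex.I * t * E) * h t :=
  hh.bdd_mul (c := 1) (Continuous.aestronglyMeasurable (by fun_prop))
    (Eventually.of_forall fun t => (norm_exp_I_mul t E).le)

theorem continuous_fourierHatInv {h : ℝ → ℂ} (hh : Integrable h) :
    Continuous (fourierHatInv h) := by
  refine continuous_const.mul (continuous_of_dominated (bound := fun t => ‖h t‖)
    (fun E => (integrable_exp_I_mul hh E).aestronglyMeasurable)
    (fun E => Eventually.of_forall fun t => ?_) hh.norm
    (Eventually.of_forall fun t => by fun_prop))
  rw [norm_mul, norm_exp_I_mul, one_mul]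

theorem norm_fourierHatInv_sub_le {h₁ h₂ : ℝ → ℂ} (hh₁ : Integrable h₁) (hh₂ : Integrable h₂)
    (E : ℝ) : ‖fourierHatInv h₁ E - fourierHatInv h₂ E‖ ≤
      (Real.sqrt (2 * Real.pi))⁻¹ * ∫ t, ‖h₁ t - h₂ t‖ := by
  rw [fourierHatInv, fourierHatInv, ← mul_sub, ← integral_sub (integrable_exp_I_mul hh₁ E)
    (integrable_exp_I_mul hh₂ E), norm_mul, Complex.norm_real,
    Real.norm_of_nonneg (by positivity)]
  refine mul_le_mul_of_nonneg_left ((norm_integral_le_integral_norm _).trans_eq ?_) (by positivity)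
  refine integral_congr_ae (Eventually.of_forall fun t => ?_)
  simp only
  rw [← mul_sub, norm_mul, norm_exp_I_mul, one_mul]

open scoped FourierTransform in
theorem ae_eq_fourierHatInv_fourierHat {g : ℝ → ℝ} (hg : Integrable g)
    (hg' : Integrable (fourierHat g)) :
    (fun E => (fourierHatInv (fourierHat g) E).re) =ᵐ[volume] g := by
  have hpi : (0 : ℝ) < 2 * Real.pi := by positivity
  have hs : (Real.sqrt (2 * Real.pi) : ℂ) ≠ 0 := by
    exact_mod_cast (Real.sqrt_pos.mpr hpi).ne'
  have hF : 𝓕 (fun x => (g x : ℂ)) = fun w =>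
      (Real.sqrt (2 * Real.pi) : ℂ) * fourierHat g (2 * Real.pi * w) := by
    ext w
    rw [fourierHat_two_pi_mul]
    push_cast
    rw [mul_inv_cancel_left₀ hs]
  have hint : Integrable (𝓕 (fun x => (g x : ℂ))) := by
    rw [hF]
    exact (hg'.comp_mul_left' hpi.ne').const_mul _
  have key : ∀ E, fourierHatInv (fourierHat g) E = 𝓕⁻ (𝓕 (fun x => (g x : ℂ))) E := by
    intro E
    rw [Real.fourierInv_eq_fourier_neg, Real.fourier_real_eq_integral_exp_smul, hF, fourierHatInv]
    have e := Measure.integral_comp_mul_left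
      (fun t : ℝ => Complex.exp (Complex.I * t * E) * fourierHat g t) (2 * Real.pi)
    have e2 : ∫ v : ℝ, Complex.exp (↑(-2 * Real.pi * v * -E) * Complex.I) •
        ((Real.sqrt (2 * Real.pi) : ℂ) * fourierHat g (2 * Real.pi * v)) =
        (Real.sqrt (2 * Real.pi) : ℂ) * ∫ x : ℝ,
          Complex.exp (Complex.I * ((2 * Real.pi * x : ℝ) : ℂ) * E) *
            fourierHat g (2 * Real.pi * x) := by
      rw [← integral_const_mul]
      congr 1
      ext v
      rw [smul_eq_mul, mul_left_comm]
      congr 3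
      push_cast
      ring
    -- The Jacobian `1/(2π)` times the normalization `√(2π)` gives the factor `(√(2π))⁻¹` of
    -- `fourierHatInv`.
    rw [e2, e, abs_of_pos (inv_pos.mpr hpi), Complex.real_smul, ← mul_assoc]
    congr 1
    rw [← Complex.ofReal_mul]
    congr 1
    have := Real.mul_self_sqrt hpi.le
    field_simp
    nlinarith [this]
  filter_upwards [ae_eq_fourierInv_fourier hg.ofReal hint] with E hE
  rw [key E]
  exact (congrArg Complex.re hE).symm

theorem integrable_exp_neg_I_mul {g : ℝ → ℝ} (hg : Integrable g) (t : ℝ) :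
    Integrable fun E : ℝ => Complex.exp (-(Complex.I * t * E)) * (g E : ℂ) :=
  hg.ofReal.bdd_mul (c := 1) (Continuous.aestronglyMeasurable (by fun_prop))
    (Eventually.of_forall fun E => (norm_exp_neg_I_mul t E).le)

theorem continuous_fourierHat {g : ℝ → ℝ} (hg : Integrable g) : Continuous (fourierHat g) := by
  refine continuous_const.mul (continuous_of_dominated (bound := fun E => ‖g E‖)
    (fun t => (integrable_exp_neg_I_mul hg t).aestronglyMeasurable)
    (fun t => Eventually.of_forall fun E => ?_) hg.norm
    (Eventually.of_forall fun E => by fun_prop))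
  rw [norm_mul, norm_exp_neg_I_mul, one_mul, Complex.norm_real]

theorem norm_fourierHat_le (g : ℝ → ℝ) (t : ℝ) :
    ‖fourierHat g t‖ ≤ (Real.sqrt (2 * Real.pi))⁻¹ * ∫ E, |g E| := by
  rw [fourierHat, norm_mul, Complex.norm_real, Real.norm_of_nonneg (by positivity)]
  refine mul_le_mul_of_nonneg_left ((norm_integral_le_integral_norm _).trans_eq ?_) (by positivity)
  refine integral_congr_ae (Eventually.of_forall fun E => ?_)
  simp only
  rw [norm_mul, norm_exp_neg_I_mul, one_mul, Complex.norm_real, Real.norm_eq_abs]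

/-- A function equal to `M` on `[-T, T]` that decays like `D |t|^(-1-ε)` beyond. -/
def decayEnvelope (M D T ε t : ℝ) : ℝ := if |t| ≤ T then M else D * |t| ^ (-(1 + ε))

theorem integral_decayEnvelope {M D T ε : ℝ} (hM : 0 < M) (hD : 0 ≤ D) (hT : 0 < T) (hε : 0 < ε) :
    Integrable (decayEnvelope M D T ε) ∧
      ∫ t, decayEnvelope M D T ε t = 2 * (T * M + D * (T ^ (-ε) / ε)) := by
  have h0 : ∫ t, decayEnvelope M D T ε t = 2 * (T * M + D * (T ^ (-ε) / ε)) := by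
    have e1 := integral_comp_abs (f := fun t => if t ≤ T then M else D * t ^ (-(1 + ε)))
    refine e1.trans ?_
    congr 1
    have hU : Ioi (0 : ℝ) = Ioc 0 T ∪ Ioi T := (Ioc_union_Ioi_eq_Ioi hT.le).symm
    have c1 : EqOn (fun t : ℝ => if t ≤ T then M else D * t ^ (-(1 + ε))) (fun _ => M) (Ioc 0 T) :=
      fun t ht => if_pos ht.2
    have c2 : EqOn (fun t : ℝ => if t ≤ T then M else D * t ^ (-(1 + ε)))
        (fun t => D * t ^ (-(1 + ε))) (Ioi T) := fun t ht => if_neg (not_le.mpr ht)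
    have hi : IntegrableOn (fun t : ℝ => D * t ^ (-(1 + ε))) (Ioi T) :=
      (integrableOn_Ioi_rpow_of_lt (by linarith) hT).const_mul D
    rw [hU, setIntegral_union (Ioc_disjoint_Ioi le_rfl)
      measurableSet_Ioi ((integrableOn_congr_fun c1 measurableSet_Ioc).mpr
        (integrableOn_const (by simp)))
      ((integrableOn_congr_fun c2 measurableSet_Ioi).mpr hi),
      setIntegral_congr_fun measurableSet_Ioc c1, setIntegral_congr_fun measurableSet_Ioi c2,
      setIntegral_const, integral_const_mul, integral_Ioi_rpow_of_lt (by linarith) hT]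
    simp only [measureReal_def, Real.volume_Ioc, sub_zero, ENNReal.toReal_ofReal hT.le, smul_eq_mul]
    congr 2
    rw [show -(1 + ε) + 1 = -ε by ring, neg_div_neg_eq]
  refine ⟨?_, h0⟩
  -- A non-integrable function has integral 0 by convention, while the computed value is positive
  -- because `M > 0`.
  by_contra hn
  rw [integral_undef hn] at h0
  have : 0 < T * M := mul_pos hT hM
  have : 0 ≤ D * (T ^ (-ε) / ε) := by positivity
  linarith

theorem div_abs_rpow_eq (D ε t : ℝ) : D / |t| ^ (1 + ε) = D * |t| ^ (-(1 + ε)) := by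
  rw [Real.rpow_neg (abs_nonneg t), div_eq_mul_inv]

/-- The decay bound is useless near `t = 0`; there the transform is bounded by the `L¹` norm of `g`.
-/
theorem integrable_fourierHat {g : ℝ → ℝ} (hg : Integrable g) {D ε : ℝ} (hD : 0 ≤ D) (hε : 0 < ε)
    (h : ∀ t : ℝ, t ≠ 0 → ‖fourierHat g t‖ ≤ D / |t| ^ (1 + ε)) : Integrable (fourierHat g) := by
  have hM : 0 < (Real.sqrt (2 * Real.pi))⁻¹ * (∫ E, |g E|) + 1 := by
    have : 0 ≤ ∫ E, |g E| := integral_nonneg fun E => abs_nonneg _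
    positivity
  refine (integral_decayEnvelope hM hD one_pos hε).1.mono'
    (continuous_fourierHat hg).aestronglyMeasurable (Eventually.of_forall fun t => ?_)
  unfold decayEnvelope
  split_ifs with ht
  · exact (norm_fourierHat_le g t).trans (by linarith)
  · rw [← div_abs_rpow_eq]
    refine h t ?_
    rintro rfl
    simp at ht

/-- Splitting the integral of a difference of Fourier transforms at `|t| = T`. -/
theorem integral_norm_sub_le {h₁ h₂ : ℝ → ℂ} {M D T ε : ℝ} (hM : 0 < M) (hD : 0 ≤ D) (hT : 0 < T)
    (hε : 0 < ε) (hsmall : ∀ t : ℝ, |t| ≤ T → ‖h₁ t - h₂ t‖ ≤ M)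
    (hd₁ : ∀ t : ℝ, t ≠ 0 → ‖h₁ t‖ ≤ D / |t| ^ (1 + ε))
    (hd₂ : ∀ t : ℝ, t ≠ 0 → ‖h₂ t‖ ≤ D / |t| ^ (1 + ε)) :
    ∫ t, ‖h₁ t - h₂ t‖ ≤ 2 * (T * M + 2 * D * (T ^ (-ε) / ε)) := by
  obtain ⟨hi, he⟩ := integral_decayEnvelope (D := 2 * D) hM (by positivity) hT hε
  rw [← he]
  refine integral_mono_of_nonneg (Eventually.of_forall fun t => norm_nonneg _) hi
    (Eventually.of_forall fun t => ?_)
  simp only [decayEnvelope]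
  split_ifs with ht
  · exact hsmall t ht
  · have ht0 : t ≠ 0 := by
      rintro rfl
      exact ht (by simpa using hT.le)
    refine (norm_sub_le _ _).trans ((add_le_add (hd₁ t ht0) (hd₂ t ht0)).trans_eq ?_)
    rw [div_abs_rpow_eq]
    ring

/-! ### Fourier transforms of density of states measures -/

theorem integrable_dosDensity (d K : ℕ) {C : ℝ} (ν : ProbabilityMeasure (Icc (-C) C)) :
    Integrable (dosDensity d K ν) :=
  Measure.integrable_toReal_rnDeriv

/-- Absolute continuity ensures that the Radon–Nikodym density captures the whole measure. -/
theorem fourierHat_dosDensity {d K : ℕ} {C : ℝ} {ν : ProbabilityMeasure (Icc (-C) C)}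
    (hac : dosMeasure d K ν ≪ volume) (t : ℝ) :
    fourierHat (dosDensity d K ν) t = ((Real.sqrt (2 * Real.pi))⁻¹ : ℝ) *
      ∫ E : ℝ, Complex.exp (-(Complex.I * t * E)) ∂(dosMeasure d K ν) := by
  rw [fourierHat, ← integral_rnDeriv_smul hac]
  congr 2
  ext E
  rw [Complex.real_smul, mul_comm]
  rfl

theorem re_exp_mul_integral_exp {n : Measure ℝ} [IsFiniteMeasure n] (t φ : ℝ) :
    (Complex.exp (φ * Complex.I) * ∫ E : ℝ, Complex.exp (-(Complex.I * t * E)) ∂n).re =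
      ∫ E, Real.cos (-t * E + φ) ∂n := by
  have hint : Integrable (fun E : ℝ => Complex.exp (φ * Complex.I) *
      Complex.exp (-(Complex.I * t * E))) n :=
    Integrable.of_bound (Continuous.aestronglyMeasurable (by fun_prop)) 1
      (Eventually.of_forall fun E => by
        rw [norm_mul, norm_exp_neg_I_mul, Complex.norm_exp_ofReal_mul_I, one_mul])
  rw [← integral_const_mul, ← RCLike.re_eq_complex_re, ← integral_re hint]
  refine integral_congr_ae (Eventually.of_forall fun E => ?_)
  simp only [RCLike.re_eq_complex_re]
  rw [← Complex.exp_add, ← Complex.exp_ofReal_mul_I_re]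
  congr 2
  push_cast
  ring

/-- Rotating the complex difference by minus its argument makes its modulus a difference of
integrals of one cosine. The argument is not known in advance, so `h` is required for every phase.
-/
theorem norm_fourierHat_dosDensity_sub_le {d K : ℕ} {C : ℝ}
    {μ ν : ProbabilityMeasure (Icc (-C) C)} (hμ : dosMeasure d K μ ≪ volume)
    (hν : dosMeasure d K ν ≪ volume) {B : ℝ} (hB : 0 ≤ B) (t : ℝ)
    (h : ∀ (φ : ℝ) (x : Site d), |∫ ω, cosElement d K C (-t) φ x ω ∂(productLaw d μ) -
      ∫ ω, cosElement d K C (-t) φ x ω ∂(productLaw d ν)| ≤ B) :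
    ‖fourierHat (dosDensity d K μ) t - fourierHat (dosDensity d K ν) t‖ ≤
      (Real.sqrt (2 * Real.pi))⁻¹ * B := by
  rw [fourierHat_dosDensity hμ, fourierHat_dosDensity hν, ← mul_sub, norm_mul, Complex.norm_real,
    Real.norm_of_nonneg (by positivity)]
  refine mul_le_mul_of_nonneg_left ?_ (by positivity)
  set z : ℂ := ∫ E : ℝ, Complex.exp (-(Complex.I * t * E)) ∂(dosMeasure d K μ) -
    ∫ E : ℝ, Complex.exp (-(Complex.I * t * E)) ∂(dosMeasure d K ν) with hz
  have e : ‖z‖ = (Complex.exp ((-z.arg : ℝ) * Complex.I) * z).re := by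
    have h1 : Complex.exp ((-z.arg : ℝ) * Complex.I) * z = ‖z‖ := by
      nth_rewrite 2 [← Complex.norm_mul_exp_arg_mul_I z]
      rw [mul_left_comm, ← Complex.exp_add]
      simp
    rw [h1, Complex.ofReal_re]
  rw [e, hz, mul_sub, Complex.sub_re, re_exp_mul_integral_exp, re_exp_mul_integral_exp]
  exact (le_abs_self _).trans (abs_integral_cos_dosMeasure_sub_le hB μ ν (-t) _ fun x => h _ x)

/-! ### Choice of the cutoff radius -/

theorem exists_radius {d : ℕ} {r T q s η : ℝ} (hr : 2 ≤ r) (hT : 1 ≤ T) (hq : 0 < q)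
    (hs0 : 0 ≤ s) (hs : s ≤ T) (hη : 0 ≤ η) (hηq : η ≤ q ^ (1 + 2 * d)) (hrT : 40 * r * q * T < 2) :
    ∃ m : ℕ, 0 < m ∧ s * r / (m + 1) ≤ 1 / 2 ∧
      8 * ((s * r) ^ m / m.factorial) + (2 * m + 1) ^ d * ((1 + s) * η) ≤ 40 * r * q * T := by
  have hrT2 : 2 ≤ r * T := by nlinarith
  have hq1 : q ≤ 1 / 40 := by nlinarith
  have hqT : q ≤ q * T := le_mul_of_one_le_right hq.le hT
  -- The radius is the first integer above `1/q`. Then `hrT` forces `s r ≤ m/20`, so the tail is at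
  -- most `(e/20)^m ≤ 2^(-m) ≤ 1/m ≤ q`.
  obtain ⟨m, hm1, hm2⟩ : ∃ m : ℕ, 1 / q < m ∧ (m : ℝ) ≤ 1 / q + 1 :=
    ⟨⌊1 / q⌋₊ + 1, by exact_mod_cast Nat.lt_floor_add_one (1 / q), by
      push_cast
      linarith [Nat.floor_le (by positivity : 0 ≤ 1 / q)]⟩
  have hmpos : (0 : ℝ) < m := lt_trans (by positivity) hm1
  have hqm : 1 < m * q := (div_lt_iff₀ hq).mp hm1
  have hx : s * r ≤ m / 20 := by
    have h1 : s * r ≤ T * r := by gcongr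
    have h2 : T * r * q ≤ m * q / 20 := by linarith
    have h3 : T * r ≤ m / 20 := by
      refine le_of_mul_le_mul_right ?_ hq
      linarith
    linarith
  have hx0 : 0 ≤ s * r := by positivity
  refine ⟨m, by exact_mod_cast hmpos, ?_, ?_⟩
  · rw [div_le_iff₀ (by positivity)]
    linarith
  have htail : (s * r) ^ m / m.factorial ≤ q := by
    calc (s * r) ^ m / m.factorial ≤ (m / 20) ^ m / m.factorial := by gcongr
      _ = (1 / 20) ^ m * ((m : ℝ) ^ m / m.factorial) := by rw [div_pow, div_pow]; ring
      _ ≤ (1 / 20) ^ m * Real.exp m := by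
          gcongr
          exact Real.pow_div_factorial_le_exp _ hmpos.le _
      _ = (Real.exp 1 / 20) ^ m := by
          rw [← Real.exp_one_pow, ← mul_pow]; ring
      _ ≤ (1 / 2) ^ m := by
          refine pow_le_pow_left₀ (by positivity) ?_ m
          linarith [Real.exp_one_lt_three]
      _ = 1 / 2 ^ m := by rw [one_div_pow]
      _ ≤ 1 / m := by
          gcongr
          exact_mod_cast Nat.lt_two_pow_self.le
      _ ≤ q := by
          rw [div_le_iff₀ hmpos]; linarith
  have hbox : (2 * (m : ℝ) + 1) ≤ 4 / q := by
    have : 3 ≤ 2 / q := by rw [le_div_iff₀ hq]; linarith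
    have e : 4 / q = 2 * (1 / q) + 2 / q := by ring
    linarith
  have hvar : (2 * (m : ℝ) + 1) ^ d * ((1 + s) * η) ≤ 2 * (q * T) := by
    -- Of the two powers of `q` available per dimension, one cancels the side length `4/q`; the
    -- other absorbs the 4, since `q ≤ 1/40`.
    calc (2 * (m : ℝ) + 1) ^ d * ((1 + s) * η)
        ≤ (4 / q) ^ d * ((T + T) * q ^ (1 + 2 * d)) := by gcongr
      _ = (4 / q * q ^ 2) ^ d * (2 * (q * T)) := by
          rw [mul_pow, pow_add, pow_mul]; ring
      _ ≤ 1 ^ d * (2 * (q * T)) := by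
          have : 4 / q * q ^ 2 ≤ 1 := by
            rw [show 4 / q * q ^ 2 = 4 * q by field_simp]
            linarith
          gcongr
      _ = 2 * (q * T) := by rw [one_pow, one_mul]
  nlinarith

theorem abs_integral_cosElement_sub_le_of_distW_le {d K : ℕ} (hd : 1 ≤ d) {C : ℝ}
    (μ ν : ProbabilityMeasure (Icc (-C) C)) {q T t : ℝ} (hq : 0 < q) (hT : 1 ≤ T) (ht : |t| ≤ T)
    (hη : distW μ ν ≤ q ^ (1 + 2 * d)) (φ : ℝ) (x : Site d) :
    |∫ ω, cosElement d K C t φ x ω ∂(productLaw d μ) -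
      ∫ ω, cosElement d K C t φ x ω ∂(productLaw d ν)| ≤ 40 * (2 * d + C) * q * T := by
  obtain ⟨x₀⟩ := nonempty_Icc_of_probabilityMeasure μ
  have hC : 0 ≤ C := (abs_nonneg _).trans (abs_le.mpr x₀.2)
  have hd' : (1 : ℝ) ≤ d := by exact_mod_cast hd
  -- When the right side is at least 2 the claim is trivial, because the matrix elements are bounded
  -- by 1.
  by_cases hcase : 40 * (2 * d + C) * q * T < 2
  · obtain ⟨m, hm, hsmall, hle⟩ := exists_radius (by linarith : (2 : ℝ) ≤ 2 * d + C) hT hq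
      (abs_nonneg t) ht (distW_nonneg μ ν) hη hcase
    exact (abs_integral_cosElement_sub_le μ ν t φ x m hm hsmall).trans hle
  · refine (abs_sub _ _).trans ?_
    linarith [abs_integral_le_of_abs_le (productLaw d μ) (abs_cosElement_le (K := K) t φ x),
      abs_integral_le_of_abs_le (productLaw d ν) (abs_cosElement_le (K := K) t φ x)]

/-! ### Sup-norm estimate for the densities -/

/-- Of the Bernstein constant only `c_b ≥ 1` matters. -/
theorem sixteen_mul_le_gammaConst {d K : ℕ} {C : ℝ} (h : 0 ≤ 2 * d + C) :
    16 * (2 * d + C) ≤ gammaConst d K C := by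
  have hb : 1 ≤ bernsteinConst := by
    have : (2 : ℝ) ≤ Real.sqrt 6 := Real.le_sqrt_of_sq_le (by norm_num)
    rw [bernsteinConst, le_div_iff₀ (by norm_num)]
    linarith
  have := le_max_left (4 * bernsteinConst * (2 * d + C)) ((K : ℝ) ^ d)
  rw [gammaConst]
  nlinarith

/-- The continuous version of the density of states function. -/
def dosDensityCont (d K : ℕ) {C : ℝ} (ν : ProbabilityMeasure (Icc (-C) C)) (E : ℝ) : ℝ :=
  (fourierHatInv (fourierHat (dosDensity d K ν)) E).re

theorem dosDensityCont_spec {d K : ℕ} {C : ℝ} {ν : ProbabilityMeasure (Icc (-C) C)} {D ε : ℝ}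
    (hD : 0 ≤ D) (hε : 0 < ε)
    (h : ∀ t : ℝ, t ≠ 0 → ‖fourierHat (dosDensity d K ν) t‖ ≤ D / |t| ^ (1 + ε)) :
    Continuous (dosDensityCont d K ν) ∧ dosDensityCont d K ν =ᵐ[volume] dosDensity d K ν := by
  have hi := integrable_fourierHat (integrable_dosDensity d K ν) hD hε h
  exact ⟨Complex.continuous_re.comp (continuous_fourierHatInv hi),
    ae_eq_fourierHatInv_fourierHat (integrable_dosDensity d K ν) hi⟩

/-- Here `q` stands for `η^(1/(1+2d))`; asking only for an upper bound on `η` keeps `q` positive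
even when `η = 0`. -/
theorem abs_dosDensityCont_sub_le {d K : ℕ} (hd : 1 ≤ d) {C : ℝ}
    {μ ν : ProbabilityMeasure (Icc (-C) C)} (hμ : dosMeasure d K μ ≪ volume)
    (hν : dosMeasure d K ν ≪ volume) {D ε : ℝ} (hD : 0 < D) (hε : 0 < ε)
    (hdμ : ∀ t : ℝ, t ≠ 0 → ‖fourierHat (dosDensity d K μ) t‖ ≤ D / |t| ^ (1 + ε))
    (hdν : ∀ t : ℝ, t ≠ 0 → ‖fourierHat (dosDensity d K ν) t‖ ≤ D / |t| ^ (1 + ε))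
    {q : ℝ} (hq : 0 < q) (hq1 : q ≤ 1) (hη : distW μ ν ≤ q ^ (1 + 2 * d)) (E : ℝ) :
    |dosDensityCont d K μ E - dosDensityCont d K ν E| ≤
      dosConst d K C D ε * q ^ (ε / (2 + ε)) := by
  obtain ⟨x₀⟩ := nonempty_Icc_of_probabilityMeasure μ
  have hC : 0 ≤ C := (abs_nonneg _).trans (abs_le.mpr x₀.2)
  have hd' : (1 : ℝ) ≤ d := by exact_mod_cast hd
  set r : ℝ := 2 * d + C with hr
  have hr2 : 2 ≤ r := by linarith
  -- This frequency cutoff balances the two errors: `T · qT` and `T^(-ε)` both equal `Q`.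
  set T : ℝ := q ^ (-(1 / (2 + ε))) with hTdef
  have hT : 1 ≤ T := Real.one_le_rpow_of_pos_of_le_one_of_nonpos hq hq1
    (neg_nonpos.mpr (by positivity))
  have hT0 : 0 < T := by linarith
  set Q : ℝ := q ^ (ε / (2 + ε)) with hQ
  have hQ0 : 0 < Q := Real.rpow_pos_of_pos hq _
  have hTQ : T ^ (-ε) = Q := by
    rw [hTdef, ← Real.rpow_mul hq.le]
    congr 1
    ring
  have hTTQ : T * (q * T) = Q := by
    have : T * (q * T) = q ^ (-(1 / (2 + ε))) * (q ^ (1 : ℝ) * q ^ (-(1 / (2 + ε)))) := by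
      rw [Real.rpow_one]
    rw [this, ← Real.rpow_add hq, ← Real.rpow_add hq, hQ]
    congr 1
    field_simp
    ring
  set σ : ℝ := (Real.sqrt (2 * Real.pi))⁻¹ with hσ
  have hσ0 : 0 < σ := by positivity
  have hiμ := integrable_fourierHat (integrable_dosDensity d K μ) hD.le hε hdμ
  have hiν := integrable_fourierHat (integrable_dosDensity d K ν) hD.le hε hdν
  have hB : 0 < 40 * r * q * T := by positivity
  have hsplit := integral_norm_sub_le (h₁ := fourierHat (dosDensity d K μ))
    (h₂ := fourierHat (dosDensity d K ν)) (M := σ * (40 * r * q * T)) (T := T)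
    (mul_pos hσ0 hB) hD.le hT0 hε (fun t ht =>
      norm_fourierHat_dosDensity_sub_le hμ hν hB.le t fun φ x =>
        abs_integral_cosElement_sub_le_of_distW_le hd μ ν hq hT (by rwa [abs_neg]) hη φ x) hdμ hdν
  have h1 : |dosDensityCont d K μ E - dosDensityCont d K ν E| ≤
      σ * (2 * (T * (σ * (40 * r * q * T)) + 2 * D * (T ^ (-ε) / ε))) := by
    unfold dosDensityCont
    rw [← Complex.sub_re]
    exact (Complex.abs_re_le_norm _).trans ((norm_fourierHatInv_sub_le hiμ hiν E).trans
      (mul_le_mul_of_nonneg_left hsplit hσ0.le))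
  refine h1.trans ?_
  rw [hTQ]
  set W : ℝ := max (gammaConst d K C) (D / ε) with hW
  have hγ : 16 * r ≤ W := (sixteen_mul_le_gammaConst (by linarith)).trans (le_max_left _ _)
  have hDW : D / ε ≤ W := le_max_right _ _
  have hW0 : 0 < W := by linarith
  have hσsq : Real.sqrt (2 / Real.pi) = 2 * σ := by
    rw [hσ, ← Real.sqrt_inv, show (2 : ℝ) = Real.sqrt 4 by
      rw [show (4 : ℝ) = 2 ^ 2 by norm_num, Real.sqrt_sq (by norm_num)], ← Real.sqrt_mul (by norm_num)]
    congr 1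
    rw [show Real.sqrt 4 = 2 by
      rw [show (4 : ℝ) = 2 ^ 2 by norm_num, Real.sqrt_sq (by norm_num)]]
    field_simp
    norm_num
  have hσ1 : σ ≤ 1 / 2 := by
    rw [hσ, inv_le_comm₀ (by positivity) (by norm_num)]
    exact Real.le_sqrt_of_sq_le (by nlinarith [Real.pi_gt_three])
  have e : σ * (2 * (T * (σ * (40 * r * q * T)) + 2 * D * (Q / ε))) =
      σ * Q * (80 * (σ * r) + 4 * (D / ε)) := by
    rw [← hTTQ]; ring
  rw [e, dosConst, hσsq, ← hW]
  -- `σ ≤ 1/2` and `16 r ≤ W` give `80 σ r ≤ 5W/2`, and the decay term is at most `4W`. The total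
  -- stays below the `8W` supplied by `4 √(2/π) = 8σ`.
  have h2 : 80 * (σ * r) + 4 * (D / ε) ≤ 8 * W := by nlinarith
  have h3 := mul_le_mul_of_nonneg_left h2 (mul_pos hσ0 hQ0).le
  linarith

theorem exists_isThreshold {d : ℕ} (hd : 1 ≤ d) {η : ℕ → ℝ} (hη : Tendsto η atTop (𝓝 0)) :
    ∃ α₀, IsThreshold d η α₀ := by
  have hd' : (0 : ℝ) < d := by exact_mod_cast hd
  have hξ : (0 : ℝ) < (1 + (2 * (d : ℝ))⁻¹)⁻¹ := by positivity
  have h := hη.rpow_const (p := (1 + (2 * (d : ℝ))⁻¹)⁻¹) (Or.inr hξ.le)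
  rw [Real.zero_rpow hξ.ne'] at h
  obtain ⟨α₀, hα₀⟩ := eventually_atTop.mp (h.eventually_le_const
    (by positivity : (0 : ℝ) < 1 / 2 ^ (2 * d)))
  exact ⟨α₀, hα₀⟩

end RandomSchrodinger
end

/-! ### Proof of the theorem -/

open RandomSchrodinger
theorem theorem5p9 (d K : ℕ) (hd : 1 ≤ d) (hK : 1 ≤ K) (C : ℝ)
    (νs : ℕ → ProbabilityMeasure (Icc (-C) C)) (ν : ProbabilityMeasure (Icc (-C) C))
    (hconv : Tendsto νs atTop (𝓝 ν))
    (hacs : ∀ α, dosMeasure d K (νs α) ≪ volume) (hac : dosMeasure d K ν ≪ volume)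
    (D₁ ε : ℝ) (hD₁ : 0 < D₁) (hε : 0 < ε)
    (hdecs : ∀ α, ∀ t : ℝ, t ≠ 0 →
      ‖fourierHat (dosDensity d K (νs α)) t‖ ≤ D₁ / |t| ^ (1 + ε))
    (hdec : ∀ t : ℝ, t ≠ 0 → ‖fourierHat (dosDensity d K ν) t‖ ≤ D₁ / |t| ^ (1 + ε)) :
    ∃ (ρs : ℕ → ℝ → ℝ) (ρ : ℝ → ℝ),
      (∀ α, Continuous (ρs α) ∧ ρs α =ᵐ[volume] dosDensity d K (νs α)) ∧
      (Continuous ρ ∧ ρ =ᵐ[volume] dosDensity d K ν) ∧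
      (∃ α₀, IsThreshold d (fun α => distW (νs α) ν) α₀) ∧
      ∀ α₀, IsThreshold d (fun α => distW (νs α) ν) α₀ → ∀ α, α₀ ≤ α → ∀ E : ℝ,
        |ρs α E - ρ E| ≤
          dosConst d K C D₁ ε * distW (νs α) ν ^ (ε / (2 + ε) * (1 / (1 + 2 * (d : ℝ)))) := by
  refine ⟨fun α => dosDensityCont d K (νs α), dosDensityCont d K ν,
    fun α => dosDensityCont_spec hD₁.le hε (hdecs α), dosDensityCont_spec hD₁.le hε hdec,
    exists_isThreshold hd (tendsto_distW hconv), fun α₀ hα₀ α hα E => ?_⟩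
  have hη0 := distW_nonneg (νs α) ν
  have hthr := hα₀ α hα
  simp only at hthr
  have hd' : (0 : ℝ) < d := by exact_mod_cast hd
  -- The threshold enters only here: `ξ₀ > 0` and `2^(-2d) ≤ 1` exclude `η > 1`.
  have hη1 : distW (νs α) ν ≤ 1 := by
    by_contra! hlt
    have h1 := Real.one_lt_rpow hlt (by positivity : (0 : ℝ) < (1 + (2 * (d : ℝ))⁻¹)⁻¹)
    have h2 : (1 : ℝ) / 2 ^ (2 * d) ≤ 1 := by
      rw [div_le_one (by positivity)]
      exact one_le_pow₀ (by norm_num)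
    linarith
  set η := distW (νs α) ν with hη
  set θ : ℝ := 1 / (1 + 2 * (d : ℝ)) with hθ
  have hθ0 : 0 < θ := by positivity
  have hpow : ∀ s : ℝ, 0 ≤ s → (s ^ θ) ^ (1 + 2 * d) = s := fun s hs => by
    rw [← Real.rpow_natCast, ← Real.rpow_mul hs]
    have : θ * ((1 + 2 * d : ℕ) : ℝ) = 1 := by
      rw [hθ]; push_cast; field_simp
    rw [this, Real.rpow_one]
  have hbound : ∀ s : ℝ, 0 < s → s ≤ 1 → η ≤ s →
      |dosDensityCont d K (νs α) E - dosDensityCont d K ν E| ≤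
        dosConst d K C D₁ ε * s ^ (ε / (2 + ε) * θ) := fun s hs hs1 hηs => by
    rw [mul_comm (ε / (2 + ε)) θ, Real.rpow_mul hs.le]
    exact abs_dosDensityCont_sub_le hd (hacs α) hac hD₁ hε (hdecs α) hdec
      (Real.rpow_pos_of_pos hs θ) (Real.rpow_le_one hs.le hs1 hθ0.le) (by rwa [hpow s hs.le]) E
  -- If `η = 0` the choice `q = η^θ` is not positive, so the bound is taken at `s > 0` and `s ↓ 0`;
  -- the exponent is positive, hence the right side is continuous at 0.
  rcases hη0.eq_or_lt with h0 | hpos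
  · have hlim : Tendsto (fun s : ℝ => dosConst d K C D₁ ε * s ^ (ε / (2 + ε) * θ)) (𝓝[>] 0)
        (𝓝 (dosConst d K C D₁ ε * η ^ (ε / (2 + ε) * θ))) := by
      rw [← h0]
      exact ((Real.continuous_rpow_const (by positivity)).tendsto 0).const_mul _
        |>.mono_left nhdsWithin_le_nhds
    refine ge_of_tendsto hlim ?_
    filter_upwards [Ioc_mem_nhdsGT one_pos] with s hs
    exact hbound s hs.1 hs.2 (by rw [← h0]; exact hs.1.le)
  · exact hbound η hpos hη1 le_rfl
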